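/- Conventions. For $f$ on an open set $\Omega\subseteq\mathbb R^3$ let $\|\nabla f\|^2_{L^2(\Omega)}\in[0,\infty]$ be defined through the weak gradient (it is $\infty$ if the weak gradient does not exist or is not square integrable). For $0<s<\frac65$ let $v_s(x)=|x|^{-s}$ on $\mathbb R^3$. For $\varepsilon>0$ let $v_{s,\varepsilon}$ stand for any function in $L^\infty(\mathbb R^3)$ with $v_{s,\varepsilon}(x)=|x|^{-s}$ for $|x|\ge\varepsilon$ and $0\le v_{s,\varepsilon}(x)\le|x|^{-s}$ for all $x$. For orbitals $\varphi_1,\dots,\varphi_N$, $N\ge1$, put $\rho_N=\sum_{i=1}^N|\varphi_i|^2$, and for $v=v_s$ or $v=v_{s,\varepsilon}$ put $v^{(N)}=N^{-\beta}v$ with $\beta=1-\frac s3$. (a) Upper bound. For every $s\in(0,\frac65)$ there is a constant $K>0$, depending only on $s$, such that for all $A>0$, all $N\ge1$, all orthonormal $\varphi_1,\dots,\varphi_N\in L^2(\mathbb R^3)$ with $$\sum_{i=1}^N\|\nabla\varphi_i\|^2_{L^2(\mathbb R^3)}\le AN,$$ all $v\in\{v_s,v_{s,\varepsilon}\}$ ($\varepsilon>0$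 arbitrary) and all $y\in\mathbb R^3$, the integral $(v^{(N)}\star\rho_N)(y)$ converges absolutely and $$(v^{(N)}\star\rho_N)(y)\le K\,A^{s/2}.$$ (b) Plane waves with constant density. Fix a density $c>0$; let $N=cL^3$, $V=[-\frac L2,\frac L2]^3$, and $$\varphi_{k}(x)=L^{-3/2}e^{i\frac{2\pi}Lk\cdot x}\mathbf 1_V(x),\qquad k\in\mathbb Z^3 .$$ For every $N\ge 1$ one can choose distinct $k_1,\dots,k_N\in\mathbb Z^3$ with $|k_i|\le|m|$ for all $i$ and all $m\in\mathbb Z^3\setminus\{k_1,\dots,k_N\}$ (the free ground state in the periodic box). For every such choice: (i) $\varphi_{k_1},\dots,\varphi_{k_N}$ are orthonormal in $L^2(\mathbb R^3)$, their density is $\rho_N=c\,\mathbf 1_V$, and their kinetic energy in the box satisfies $$\sum_{i=1}^N\|\nabla\varphi_{k_i}\|^2_{L^2(\mathrm{int}\,V)}=\sum_{i=1}^N\Big(\frac{2\pi}L\Big)^2|k_i|^2\le A_0\,c^{2/3}N$$ with a constant $A_0$ independent of $c$ and $N$. (ii) For every $s\in(0,\frac65)$ there is $K>0$, depending only on $s$,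 such that for $v\in\{v_s,v_{s,\varepsilon}\}$, all $c>0$, $N\ge1$ and all $y\in\mathbb R^3$, the integral converges absolutely and $(v^{(N)}\star\rho_N)(y)\le K\,c^{s/3}$. (iii) For every $s\in(0,\frac65)$ and every $\kappa>0$ there is $K'>0$, depending only on $s$ and $\kappa$, such that for every $c>0$ $$(v^{(N)}\star\rho_N)(y)\ge K'\,c^{s/3}\qquad\text{for all } y \text{ with } |y|\le\kappa L .$$ For $v=v_s$ this holds for all $N\ge1$; for $v=v_{s,\varepsilon}$ it holds for all $N\ge N_0$, where $N_0$ may depend on $s,\kappa,c,\varepsilon$ but not on the particular function $v_{s,\varepsilon}$. In particular, for every fixed $y\in\mathbb R^3$, $(v^{(N)}\star\rho_N)(y)$ is bounded below by a positive constant independent of $N$ (for $v_s$ for all $N$, for $v_{s,\varepsilon}$ for all large $N$). So $v\star\rho_N$ is of the exact order $N^{1-s/3}$ for plane waves, and $\beta=1-\frac s3$ is the correct scaling exponent. -/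

import Mathlib

open MeasureTheory
open scoped ENNReal ContDiff

/-- Physical space `ℝ³` with its Euclidean norm and Lebesgue measure. -/
abbrev Space3 : Type := EuclideanSpace ℝ (Fin 3)

/-! ### Weak gradients and kinetic energy -/

/-- `G = (G₀, G₁, G₂)` is the weak (distributional) gradient of `f` on the open set `Ω ⊆ ℝ³`:
`∫_Ω (∂ⱼ η) f = - ∫_Ω η Gⱼ` for all test functions `η ∈ C_c^∞(Ω)`.
(Real test functions suffice, by linearity.) -/
structure HasWeakGradientOn (Ω : Set Space3) (f : Space3 → ℂ) (G : Fin 3 → Space3 → ℂ) :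
    Prop where
  locallyIntegrableOn : LocallyIntegrableOn f Ω volume
  grad_locallyIntegrableOn : ∀ j, LocallyIntegrableOn (G j) Ω volume
  integral_eq : ∀ (j : Fin 3) (η : Space3 → ℝ), ContDiff ℝ ∞ η → HasCompactSupport η →
    tsupport η ⊆ Ω →
    ∫ x in Ω, (fderiv ℝ η x (EuclideanSpace.single j 1)) • f x = - ∫ x in Ω, η x • G j x

/-- `‖∇f‖²_{L²(Ω)} ∈ [0, ∞]`. The weak gradient is unique almost everywhere, so the infimum is
over at most one value; it is `∞` if `f` has no weak gradient on `Ω`. -/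
noncomputable def gradNormSq (Ω : Set Space3) (f : Space3 → ℂ) : ℝ≥0∞ :=
  ⨅ (G : Fin 3 → Space3 → ℂ) (_ : HasWeakGradientOn Ω f G),
    ∫⁻ x in Ω, ∑ j, ‖G j x‖ₑ ^ 2

/-- The kinetic energy `∑ᵢ ‖∇φᵢ‖²_{L²(Ω)}` of the orbitals `φ₁, …, φ_N`. -/
noncomputable def kineticEnergyOn (Ω : Set Space3) {N : ℕ} (φ : Fin N → Space3 → ℂ) : ℝ≥0∞ :=
  ∑ i, gradNormSq Ω (φ i)

/-! ### Orbitals, density, mean field -/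

/-- The functions `φ₁, …, φ_N` belong to `L²(ℝ³)` and are orthonormal there. -/
def OrthonormalOrbitals {N : ℕ} (φ : Fin N → Space3 → ℂ) : Prop :=
  ∃ h : ∀ i, MemLp (φ i) 2 (volume : Measure Space3),
    Orthonormal ℂ (fun i => (h i).toLp (φ i))

/-- The density `ρ_N = ∑ᵢ |φᵢ|²`. -/
noncomputable def density {N : ℕ} (φ : Fin N → Space3 → ℂ) (x : Space3) : ℝ :=
  ∑ i, ‖φ i x‖ ^ 2

/-- The scaled interaction `v^{(N)} = N^{-β} v`. -/
noncomputable def scaledPotential (N : ℕ) (β : ℝ) (v : Space3 → ℝ) (x : Space3) : ℝ :=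
  (N : ℝ) ^ (-β) * v x

/-- The integral defining `(v ⋆ ρ)(y)` converges absolutely. -/
def ConvExistsAt (v ρ : Space3 → ℝ) (y : Space3) : Prop :=
  ConvolutionExistsAt v ρ y (ContinuousLinearMap.mul ℝ ℝ) volume

/-- `(v ⋆ ρ)(y) = ∫ v(x) ρ(y - x) dx`. -/
noncomputable def conv (v ρ : Space3 → ℝ) (y : Space3) : ℝ :=
  convolution v ρ (ContinuousLinearMap.mul ℝ ℝ) volume y

/-! ### Interactions -/

/-- `v_s(x) = |x|^{-s}` (with an irrelevant value at the origin). -/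
noncomputable def powerPotential (s : ℝ) (x : Space3) : ℝ := ‖x‖ ^ (-s)

/-- `v` is one of the interactions `v_{s,ε}`: `v ∈ L^∞`, `v(x) = |x|^{-s}` for `|x| ≥ ε`, and
`0 ≤ v(x) ≤ |x|^{-s}` everywhere (the upper bound being void at the origin). -/
structure IsCutoffPotential (s ε : ℝ) (v : Space3 → ℝ) : Prop where
  memLp : MemLp v ∞ (volume : Measure Space3)
  eq_of_le : ∀ x, ε ≤ ‖x‖ → v x = ‖x‖ ^ (-s)
  nonneg : ∀ x, 0 ≤ v x
  le_power : ∀ x, x ≠ 0 → v x ≤ ‖x‖ ^ (-s)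

/-! ### Plane waves in a box -/

/-- The box `[-L/2, L/2]³`. -/
def box (L : ℝ) : Set Space3 := {x | ∀ j, |x j| ≤ L / 2}

/-- The plane wave `L^{-3/2} e^{i (2π/L) k·x} 𝟙_V(x)`, where `V` is the box of side `L` and
`k ∈ ℤ³`. -/
noncomputable def planeWave (L : ℝ) (k : Fin 3 → ℤ) : Space3 → ℂ :=
  (box L).indicator fun x =>
    ((L ^ (-(3 / 2 : ℝ)) : ℝ) : ℂ) *
      Complex.exp (Complex.I * ((2 * Real.pi / L * ∑ j, (k j : ℝ) * x j : ℝ) : ℂ))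

/-- `k₁, …, k_N ∈ ℤ³` are distinct and have the smallest possible lengths `|k|`: the momenta of
the free ground state of `N` fermions in a periodic box. -/
def IsGroundStateMomenta {N : ℕ} (k : Fin N → Fin 3 → ℤ) : Prop :=
  Function.Injective k ∧
    ∀ m : Fin 3 → ℤ, m ∉ Set.range k → ∀ i, ∑ j, k i j ^ 2 ≤ ∑ j, m j ^ 2

/-- The side length `L` of the box that holds `N` particles at density `c`, i.e. `N = c L³`. -/
noncomputable def sideLength (c : ℝ) (N : ℕ) : ℝ := ((N : ℝ) / c) ^ (1 / 3 : ℝ)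

/-- The `N` plane waves with momenta `k₁, …, k_N` in the box of density `c`. -/
noncomputable def planeWaves (c : ℝ) {N : ℕ} (k : Fin N → Fin 3 → ℤ) :
    Fin N → Space3 → ℂ :=
  fun i => planeWave (sideLength c N) (k i)

/-! Both upper bounds follow from one potential estimate: if a density has total mass at most `N`
and puts mass at most `D r ^ p` in every ball of radius `r`, with `s < p`, then its convolution with
a kernel dominated by `‖x‖ ^ (-s)` is at most a constant times `N ^ (1 - s / p) * D ^ (s / p)`
(`convExistsAt_and_conv_le`).

For orbitals of kinetic energy at most `T`, each orbital is split at `x` into its average over the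
ball of radius `l` and an oscillation. By Bessel's inequality the averages together contribute a
density of order `l⁻³`, whatever the number of orbitals; this is where orthonormality matters. By
the translation estimate `‖f(· + h) - f‖₂ ≤ |h| ‖∇f‖₂` the oscillations contribute total mass of
order `l² T`. A ball of radius `r` thus has mass at most a constant times `r³ / l³ + l² T`, and the
best `l` gives `T ^ (3/5) * r ^ (6/5)`. Hence `p = 6/5` and the restriction `s < 6/5`; with `T = A
N` the potential estimate yields `N ^ (1 - s/3) * A ^ (s/2)`.

Plane waves cut off at the boundary of the box jump there and have no finite kinetic energy on the
whole space, so the first bound does not apply to them. Their density is the constant `c` on the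
box, so `p = 3` and `D` proportional to `c` serve instead. For the lower bound, every point of the
box is within `(κ + 1) L` of `y`, so a kernel known away from a small ball is at least `((κ + 1) L)
^ (-s)` on at least half of the mass `N`. -/

/-! ### Potential estimate from the growth of mass in balls -/

/-- A measure of total mass at most `N` that gives mass at most `D r ^ p` to balls of radius `r`
about the origin integrates `‖x‖ ^ (-s)` for `s < p`, with the bound obtained by splitting the
layer-cake integral at the optimal radius. -/
lemma lintegral_norm_rpow_neg_le (μ : Measure Space3) {s p N D : ℝ} (hs : 0 < s) (hsp : s < p)
    (hN : 0 < N) (hD : 0 < D) (huniv : μ Set.univ ≤ ENNReal.ofReal N)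
    (hball : ∀ r : ℝ, 0 < r → μ (Metric.closedBall 0 r) ≤ ENNReal.ofReal (D * r ^ p)) :
    ∫⁻ x, ENNReal.ofReal (‖x‖ ^ (-s)) ∂μ ≤
      ENNReal.ofReal (p / (p - s) * (N ^ (1 - s / p) * D ^ (s / p))) := by
  have hp : 0 < p := hs.trans hsp
  have hps : 0 < p - s := sub_pos.2 hsp
  have h1 : ∀ x : Space3, ‖x‖ ^ (-s) = (‖x‖⁻¹) ^ s := fun x => by
    rw [Real.inv_rpow (norm_nonneg x), Real.rpow_neg (norm_nonneg x)]
  simp_rw [h1]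
  -- Layer-cake formula for the function `‖x‖⁻¹`.
  rw [lintegral_rpow_eq_lintegral_meas_le_mul μ
    (Filter.Eventually.of_forall fun x => by simp) (by fun_prop) hs]
  -- At `t = T` the two available bounds on `μ {t ≤ ‖a‖⁻¹}`, namely `N` and `D * t ^ (-p)`,
  -- coincide; the first is used below `T`, the second above.
  set T : ℝ := (D / N) ^ (1 / p) with hT
  have hT0 : 0 < T := by positivity
  have hsplit : Set.Ioi (0 : ℝ) = Set.Ioc 0 T ∪ Set.Ioi T := (Set.Ioc_union_Ioi_eq_Ioi hT0.le).symm
  have hlow : ∫⁻ t in Set.Ioc 0 T, μ {a | t ≤ ‖a‖⁻¹} * ENNReal.ofReal (t ^ (s - 1)) ≤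
      ENNReal.ofReal (N * (T ^ s / s)) := by
    calc _ ≤ ∫⁻ t in Set.Ioc 0 T, ENNReal.ofReal (N * t ^ (s - 1)) := by
          refine lintegral_mono fun t => ?_
          rw [ENNReal.ofReal_mul hN.le]
          gcongr
          exact (measure_mono (Set.subset_univ _)).trans huniv
      _ = ENNReal.ofReal (∫ t in Set.Ioc 0 T, N * t ^ (s - 1)) := by
          rw [ofReal_integral_eq_lintegral_ofReal]
          · have := (intervalIntegral.intervalIntegrable_rpow' (a := 0) (b := T)
              (r := s - 1) (by linarith)).const_mul N
            rwa [intervalIntegrable_iff_integrableOn_Ioc_of_le hT0.le] at this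
          · refine (ae_restrict_iff' measurableSet_Ioc).2 (Filter.Eventually.of_forall fun t ht => ?_)
            have := ht.1
            simp only [Pi.zero_apply]; positivity
      _ = _ := by
          rw [integral_const_mul, ← intervalIntegral.integral_of_le hT0.le,
            integral_rpow (Or.inl (by linarith))]
          simp [Real.zero_rpow hs.ne']
  have hhigh : ∫⁻ t in Set.Ioi T, μ {a | t ≤ ‖a‖⁻¹} * ENNReal.ofReal (t ^ (s - 1)) ≤
      ENNReal.ofReal (D * (T ^ (s - p) / (p - s))) := by
    calc _ ≤ ∫⁻ t in Set.Ioi T, ENNReal.ofReal (D * t ^ (s - p - 1)) := by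
          refine setLIntegral_mono' measurableSet_Ioi fun t ht => ?_
          have ht0 : 0 < t := hT0.trans ht
          have : D * t ^ (s - p - 1) = (D * (t⁻¹) ^ p) * t ^ (s - 1) := by
            rw [Real.inv_rpow ht0.le, ← Real.rpow_neg ht0.le, mul_assoc, ← Real.rpow_add ht0]
            congr 2; ring
          rw [this, ENNReal.ofReal_mul (by positivity)]
          gcongr
          -- The superlevel set lies in the ball of radius `t⁻¹`. The origin is not in it, because
          -- `‖0‖⁻¹ = 0 < t`.
          refine (measure_mono fun a (ha : t ≤ ‖a‖⁻¹) => ?_).trans (hball _ (inv_pos.2 ht0))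
          have h0 : 0 < ‖a‖ := inv_pos.1 (ht0.trans_le ha)
          simpa using (le_inv_comm₀ ht0 h0).1 ha
      _ = ENNReal.ofReal (∫ t in Set.Ioi T, D * t ^ (s - p - 1)) := by
          rw [ofReal_integral_eq_lintegral_ofReal]
          · exact (integrableOn_Ioi_rpow_of_lt (by linarith) hT0).const_mul D
          · refine (ae_restrict_iff' measurableSet_Ioi).2 (Filter.Eventually.of_forall fun t ht => ?_)
            have : 0 < t := hT0.trans ht
            simp only [Pi.zero_apply]; positivity
      _ = _ := by
          rw [integral_const_mul, integral_Ioi_rpow_of_lt (by linarith) hT0]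
          congr 2
          rw [show s - p - 1 + 1 = s - p by ring, ← neg_sub p s, div_neg, neg_div, neg_neg]
  rw [hsplit, lintegral_union measurableSet_Ioi (Set.Ioc_disjoint_Ioi le_rfl)]
  refine (mul_le_mul_right (add_le_add hlow hhigh) _).trans ?_
  rw [← ENNReal.ofReal_add (by positivity) (by positivity), ← ENNReal.ofReal_mul hs.le]
  apply ENNReal.ofReal_le_ofReal
  have e1 : N * T ^ s = N ^ (1 - s / p) * D ^ (s / p) := by
    rw [hT, ← Real.rpow_mul (by positivity), Real.div_rpow hD.le hN.le, Real.rpow_sub hN,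
      Real.rpow_one]
    rw [show 1 / p * s = s / p by ring]
    field_simp
  have e2 : D * T ^ (s - p) = N ^ (1 - s / p) * D ^ (s / p) := by
    rw [hT, ← Real.rpow_mul (by positivity), Real.div_rpow hD.le hN.le,
      show 1 / p * (s - p) = s / p - 1 by field_simp, Real.rpow_sub hD, Real.rpow_sub hN,
      Real.rpow_sub hN, Real.rpow_one, Real.rpow_one]
    field_simp
  refine le_of_eq ?_
  rw [← mul_div_assoc, ← mul_div_assoc, e1, e2]
  field_simp
  ring

/-- Convolution of a kernel dominated by `‖x‖ ^ (-s)` with a density of total mass at most `N`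
that gives mass at most `D r ^ p` to every ball of radius `r`. -/
lemma convExistsAt_and_conv_le {s p N D b : ℝ} (hs : 0 < s) (hsp : s < p) (hN : 0 < N) (hD : 0 < D)
    (hb : 0 ≤ b) {v ρ : Space3 → ℝ} (hvm : AEStronglyMeasurable v volume) (hv0 : ∀ x, 0 ≤ v x)
    (hv : ∀ x, x ≠ 0 → v x ≤ ‖x‖ ^ (-s)) (hρm : AEStronglyMeasurable ρ volume)
    (hρ0 : ∀ x, 0 ≤ ρ x) (hmass : ∫⁻ x, ENNReal.ofReal (ρ x) ≤ ENNReal.ofReal N)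
    (hball : ∀ (y : Space3) (r : ℝ), 0 < r →
      ∫⁻ x in Metric.closedBall y r, ENNReal.ofReal (ρ x) ≤ ENNReal.ofReal (D * r ^ p))
    (y : Space3) :
    ConvExistsAt (fun x => b * v x) ρ y ∧
      conv (fun x => b * v x) ρ y ≤ b * (p / (p - s) * (N ^ (1 - s / p) * D ^ (s / p))) := by
  have hps : 0 < p - s := sub_pos.2 hsp
  have hp : 0 < p := hs.trans hsp
  set B : ℝ := p / (p - s) * (N ^ (1 - s / p) * D ^ (s / p)) with hB
  have hB0 : 0 ≤ B := by positivity
  have hρy : AEStronglyMeasurable (fun t => ρ (y - t)) volume :=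
    hρm.comp_quasiMeasurePreserving (quasiMeasurePreserving_sub_left volume y)
  have hd : AEMeasurable (fun t => ENNReal.ofReal (ρ (y - t))) volume :=
    hρy.aemeasurable.ennreal_ofReal
  have key : ∫⁻ t, ENNReal.ofReal (v t * ρ (y - t)) ≤ ENNReal.ofReal B := by
    calc ∫⁻ t, ENNReal.ofReal (v t * ρ (y - t))
        ≤ ∫⁻ t, ENNReal.ofReal (ρ (y - t)) * ENNReal.ofReal (‖t‖ ^ (-s)) := by
          refine lintegral_mono_ae ?_
          have : ∀ᵐ t : Space3 ∂volume, t ≠ 0 := Measure.ae_ne volume 0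
          filter_upwards [this] with t ht
          rw [← ENNReal.ofReal_mul (hρ0 _), mul_comm]
          exact ENNReal.ofReal_le_ofReal (mul_le_mul_of_nonneg_left (hv t ht) (hρ0 _))
      -- The reflected and translated density becomes the measure of the previous lemma, so balls
      -- about the origin correspond to balls about `y`.
      _ = ∫⁻ t, ENNReal.ofReal (‖t‖ ^ (-s))
            ∂(volume.withDensity fun t => ENNReal.ofReal (ρ (y - t))) := by
          rw [lintegral_withDensity_eq_lintegral_mul_non_measurable₀ _ hd
            (Filter.Eventually.of_forall fun _ => ENNReal.ofReal_lt_top)]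
          rfl
      _ ≤ ENNReal.ofReal B := by
          refine lintegral_norm_rpow_neg_le _ hs hsp hN hD ?_ fun r hr => ?_
          · rw [withDensity_apply _ MeasurableSet.univ, Measure.restrict_univ,
              lintegral_sub_left_eq_self (fun x => ENNReal.ofReal (ρ x)) y]
            exact hmass
          · rw [withDensity_apply _ Metric.isClosed_closedBall.measurableSet]
            refine le_trans (le_of_eq ?_) (hball y r hr)
            rw [← lintegral_indicator Metric.isClosed_closedBall.measurableSet,
              ← lintegral_indicator Metric.isClosed_closedBall.measurableSet,
              ← lintegral_sub_left_eq_self _ y]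
            congr 1; ext t
            simp [Set.indicator, dist_eq_norm, norm_sub_rev y t]
  have hint : Integrable (fun t => v t * ρ (y - t)) volume := by
    refine ⟨hvm.mul hρy, ?_⟩
    rw [hasFiniteIntegral_iff_ofReal
      (Filter.Eventually.of_forall fun t => mul_nonneg (hv0 t) (hρ0 _))]
    exact key.trans_lt ENNReal.ofReal_lt_top
  have hval : ∫ t, v t * ρ (y - t) ≤ B := by
    rw [integral_eq_lintegral_of_nonneg_ae
      (Filter.Eventually.of_forall fun t => mul_nonneg (hv0 t) (hρ0 _)) hint.1]
    exact ENNReal.toReal_le_of_le_ofReal hB0 key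
  constructor
  · have := hint.const_mul b
    simpa [ConvExistsAt, ConvolutionExistsAt, mul_assoc] using this
  · have : conv (fun x => b * v x) ρ y = b * ∫ t, v t * ρ (y - t) := by
      simp [conv, convolution_def, mul_assoc, integral_const_mul]
    rw [this]
    exact mul_le_mul_of_nonneg_left hval hb

/-! ### Translation estimate for functions with a weak gradient -/

lemma lintegral_enorm_sq_eq {α E : Type*} [MeasurableSpace α] {μ : Measure α}
    [NormedAddCommGroup E] {f : α → E} (hf : MemLp f 2 μ) :
    ∫⁻ x, ‖f x‖ₑ ^ 2 ∂μ = ENNReal.ofReal (‖hf.toLp f‖ ^ 2) := by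
  have := eLpNorm_nnreal_pow_eq_lintegral (p := 2) (f := f) (μ := μ) two_ne_zero
  norm_num at this
  rw [← this, Lp.norm_toLp, ENNReal.ofReal_pow ENNReal.toReal_nonneg,
    ENNReal.ofReal_toReal hf.eLpNorm_ne_top]

lemma inner_toLp_toLp {α : Type*} [MeasurableSpace α] {μ : Measure α} {f g : α → ℝ}
    (hf : MemLp f 2 μ) (hg : MemLp g 2 μ) :
    inner ℝ (hf.toLp f) (hg.toLp g) = ∫ x, f x * g x ∂μ := by
  rw [L2.inner_def]
  refine integral_congr_ae ?_
  filter_upwards [hf.coeFn_toLp, hg.coeFn_toLp] with x h1 h2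
  rw [h1, h2]
  simp [mul_comm]

/-- The `L²` norm is controlled by testing against smooth compactly supported functions. -/
lemma norm_le_of_forall_test {f : Space3 → ℝ} (hf : MemLp f 2 volume) {C : ℝ} (hC : 0 ≤ C)
    (h : ∀ (ψ : Space3 → ℝ) (hψ : MemLp ψ 2 volume), ContDiff ℝ ∞ ψ → HasCompactSupport ψ →
      |∫ x, f x * ψ x| ≤ C * ‖hψ.toLp ψ‖) :
    ‖hf.toLp f‖ ≤ C := by
  set F := hf.toLp f with hF
  -- With a test function `g` within `δ` of `F` in `L²`, write `⟪F, F⟫ = ⟪F, F - g⟫ + ⟪F, g⟫`: the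
  -- first term is at most `‖F‖ δ`, the second at most `C (‖F‖ + δ)`.
  have key : ∀ δ : ℝ, 0 < δ → ‖F‖ ^ 2 ≤ C * ‖F‖ + (‖F‖ + C) * δ := by
    intro δ hδ
    obtain ⟨g, hgc, hgs, hg⟩ := hf.exist_eLpNorm_sub_le (by simp) (by norm_num) hδ
    have hgL : MemLp g 2 volume := hgs.continuous.memLp_of_hasCompactSupport hgc
    have h1 : ‖F - hgL.toLp g‖ ≤ δ := by
      rw [hF, ← MemLp.toLp_sub, Lp.norm_toLp]
      exact ENNReal.toReal_le_of_le_ofReal hδ.le hg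
    have h2 := h g hgL hgs hgc
    rw [← inner_toLp_toLp hf hgL, ← hF] at h2
    have h3 : ‖hgL.toLp g‖ ≤ ‖F‖ + δ := by
      have := norm_sub_le F (F - hgL.toLp g)
      rw [sub_sub_cancel] at this
      linarith
    have h4 : inner ℝ F (F - hgL.toLp g) ≤ ‖F‖ * δ :=
      (real_inner_le_norm _ _).trans (mul_le_mul_of_nonneg_left h1 (norm_nonneg _))
    have h5 : inner ℝ F F = ‖F‖ ^ 2 := real_inner_self_eq_norm_sq F
    rw [inner_sub_right, h5] at h4
    have h6 := (le_abs_self _).trans h2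
    have h7 := mul_le_mul_of_nonneg_left h3 hC
    linarith
  have h0 : ‖F‖ ^ 2 ≤ C * ‖F‖ := by
    refine le_of_forall_pos_le_add fun ε hε => ?_
    have hp : 0 < ‖F‖ + C + 1 := by positivity
    refine (key (ε / (‖F‖ + C + 1)) (by positivity)).trans ?_
    have : (‖F‖ + C) * (ε / (‖F‖ + C + 1)) ≤ ε := by
      rw [mul_div_assoc', div_le_iff₀ hp]
      nlinarith
    linarith
  rcases (norm_nonneg F).eq_or_lt with h | h
  · rw [← h]; exact hC
  · rw [pow_two] at h0
    exact le_of_mul_le_mul_right h0 h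

/-- Translation estimate for a real function with square integrable weak gradient. -/
lemma lintegral_enorm_translate_sub_sq_le_real {f : Space3 → ℝ} {G : Fin 3 → Space3 → ℝ}
    (hf : MemLp f 2 volume) (hG : ∀ j, MemLp (G j) 2 volume)
    (hw : ∀ (j : Fin 3) (η : Space3 → ℝ), ContDiff ℝ ∞ η → HasCompactSupport η →
      ∫ x, fderiv ℝ η x (EuclideanSpace.single j 1) * f x = - ∫ x, η x * G j x) (h : Space3) :
    ∫⁻ x, ‖f (x + h) - f x‖ₑ ^ 2 ≤
      ENNReal.ofReal (‖h‖ ^ 2) * ∑ j, ∫⁻ x, ‖G j x‖ₑ ^ 2 := by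
  have hfh : MemLp (fun x => f (x + h)) 2 volume :=
    hf.comp_measurePreserving (measurePreserving_add_right volume h)
  have hd : MemLp (fun x => f (x + h) - f x) 2 volume := hfh.sub hf
  set a : Fin 3 → ℝ := fun j => ‖(hG j).toLp (G j)‖ with ha
  have ha0 : ∀ j, 0 ≤ a j := fun j => norm_nonneg _
  set C : ℝ := ∑ j, |h j| * a j with hCdef
  have hC0 : 0 ≤ C := Finset.sum_nonneg fun j _ => mul_nonneg (abs_nonneg _) (ha0 j)
  have hCsq : C ^ 2 ≤ ‖h‖ ^ 2 * ∑ j, a j ^ 2 := by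
    have := Finset.sum_mul_sq_le_sq_mul_sq Finset.univ (fun j => |h j|) a
    rw [EuclideanSpace.norm_sq_eq]
    simpa using this
  rw [lintegral_enorm_sq_eq hd]
  simp_rw [fun j => lintegral_enorm_sq_eq (hG j)]
  rw [← ENNReal.ofReal_sum_of_nonneg fun j _ => by positivity,
    ← ENNReal.ofReal_mul (by positivity)]
  refine ENNReal.ofReal_le_ofReal (le_trans ?_ hCsq)
  refine pow_le_pow_left₀ (norm_nonneg _) (norm_le_of_forall_test hd hC0 ?_) 2
  intro ψ hψ hψs hψc
  -- Duality puts all derivatives on `ψ`. With `g` the reflection of `ψ`, the function `Φ t = ∫ f x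
  -- * ψ (x - t • h)` is a convolution evaluated on a line, hence differentiable without any
  -- smoothness of `f`, and `Φ 1 - Φ 0` is the pairing to be bounded.
  set g : Space3 → ℝ := fun x => ψ (-x) with hg
  have hgs : ContDiff ℝ ∞ g := hψs.comp contDiff_neg
  have hgc : HasCompactSupport g := hψc.comp_homeomorph (Homeomorph.neg Space3)
  have hfl : LocallyIntegrable f volume := hf.locallyIntegrable (by norm_num)
  set Lm := ContinuousLinearMap.mul ℝ ℝ with hLm
  set Φ : ℝ → ℝ := fun t => convolution f g Lm volume (t • h) with hΦ
  set Φ' : ℝ → ℝ := fun t => ∫ x, f x * fderiv ℝ g (t • h - x) h with hΦ'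
  have hderiv : ∀ t, HasDerivAt Φ (Φ' t) t := by
    intro t
    have h1 := hgc.hasFDerivAt_convolution_right Lm hfl (hgs.of_le (by simp)) (t • h)
    have h2 : HasDerivAt (fun t : ℝ => t • h) h t := by
      simpa using (hasDerivAt_id t).smul_const h
    have h3 := h1.comp_hasDerivAt t h2
    rw [convolution_precompR_apply Lm hfl (hgc.fderiv ℝ)
      (hgs.continuous_fderiv (by simp))] at h3
    exact h3
  have hbound : ∀ t, ‖Φ' t‖ ≤ C * ‖hψ.toLp ψ‖ := by
    intro t
    set η : Space3 → ℝ := fun x => ψ (x - t • h) with hη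
    have hηs : ContDiff ℝ ∞ η := hψs.comp (contDiff_id.sub contDiff_const)
    have hηc : HasCompactSupport η := hψc.comp_homeomorph (Homeomorph.subRight (t • h))
    have hηL : MemLp η 2 volume := hηs.continuous.memLp_of_hasCompactSupport hηc
    have hηn : ‖hηL.toLp η‖ = ‖hψ.toLp ψ‖ := by
      rw [Lp.norm_toLp, Lp.norm_toLp]
      congr 1
      exact eLpNorm_comp_measurePreserving hψ.1 (measurePreserving_sub_right volume (t • h))
    have hηg : ∀ x v, fderiv ℝ η x v = - fderiv ℝ g (t • h - x) v := by
      intro x v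
      have e : η = fun x => g (t • h - x) := by
        ext x; simp [hη, hg]
      have h1 : HasFDerivAt η ((fderiv ℝ g (t • h - x)).comp (-ContinuousLinearMap.id ℝ Space3)) x := by
        rw [e]
        have h2 : HasFDerivAt (fun y : Space3 => t • h - y) (-ContinuousLinearMap.id ℝ Space3) x :=
          (hasFDerivAt_id x).const_sub (t • h)
        exact HasFDerivAt.comp (g := g) x
          ((hgs.differentiable (by simp)).differentiableAt).hasFDerivAt h2
      rw [h1.fderiv]
      simp
    have hh : h = ∑ j, h j • EuclideanSpace.single j (1 : ℝ) := by
      ext i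
      simp [Finset.sum_apply, Pi.single_apply]
    have hint : ∀ j : Fin 3, Integrable (fun x => fderiv ℝ η x (EuclideanSpace.single j 1) * f x) := by
      intro j
      have hc : Continuous fun x => fderiv ℝ η x (EuclideanSpace.single j 1) :=
        (hηs.continuous_fderiv (by simp)).clm_apply continuous_const
      have hs : HasCompactSupport fun x => fderiv ℝ η x (EuclideanSpace.single j 1) :=
        hηc.fderiv_apply ℝ _
      exact hfl.integrable_smul_left_of_hasCompactSupport hc hs
    -- The derivative along `h` is expanded in coordinates and the weak gradient identity is applied
    -- with the translated test function `η`, whose `L²` norm is that of `ψ`.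
    have e1 : Φ' t = ∑ j, h j * ∫ x, η x * G j x := by
      have : ∀ x, f x * fderiv ℝ g (t • h - x) h =
          - ∑ j, h j * (fderiv ℝ η x (EuclideanSpace.single j 1) * f x) := by
        intro x
        conv_lhs => rw [hh, map_sum]
        simp only [map_smul, smul_eq_mul, hηg, Finset.mul_sum, ← Finset.sum_neg_distrib]
        refine Finset.sum_congr rfl fun j _ => ?_
        ring_nf
        rw [← hh]
      simp only [hΦ', this]
      rw [integral_neg, integral_finsetSum _ fun j _ => (hint j).const_mul _,
        ← Finset.sum_neg_distrib]
      refine Finset.sum_congr rfl fun j _ => ?_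
      rw [integral_const_mul, hw j η hηs hηc]
      ring
    rw [e1, hCdef, Finset.sum_mul]
    refine (norm_sum_le _ _).trans (Finset.sum_le_sum fun j _ => ?_)
    rw [norm_mul, Real.norm_eq_abs, mul_assoc]
    refine mul_le_mul_of_nonneg_left ?_ (abs_nonneg _)
    rw [← inner_toLp_toLp hηL (hG j), ← hηn, mul_comm]
    exact norm_inner_le_norm _ _
  have hmv := Convex.norm_image_sub_le_of_norm_hasDerivWithin_le (f := Φ) (s := Set.univ)
    (x := 0) (y := 1) (fun t _ => (hderiv t).hasDerivWithinAt) (fun t _ => hbound t)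
    convex_univ trivial trivial
  have hval : Φ 1 - Φ 0 = ∫ x, (f (x + h) - f x) * ψ x := by
    have i1 : Integrable fun x => f (x + h) * ψ x := hfh.integrable_mul hψ
    have i2 : Integrable fun x => f x * ψ x := hf.integrable_mul hψ
    simp only [sub_mul]
    rw [integral_sub i1 i2, ← integral_sub_right_eq_self (fun x => f (x + h) * ψ x) h]
    simp [hΦ, convolution_def, hg, hLm]
  rw [hval] at hmv
  simpa using hmv

lemma ENNReal.add_sq_le_two_mul (a b : ℝ≥0∞) : (a + b) ^ 2 ≤ 2 * a ^ 2 + 2 * b ^ 2 := by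
  have := ENNReal.rpow_add_le_mul_rpow_add_rpow a b (p := 2) (by norm_num)
  norm_num at this
  rwa [mul_add] at this

lemma enorm_sq_eq_re_add_im (z : ℂ) : ‖z‖ₑ ^ 2 = ‖z.re‖ₑ ^ 2 + ‖z.im‖ₑ ^ 2 := by
  simp only [← ofReal_norm, ← ENNReal.ofReal_pow (norm_nonneg _)]
  rw [← ENNReal.ofReal_add (by positivity) (by positivity), ← Complex.normSq_eq_norm_sq,
    Complex.normSq_apply]
  simp [pow_two]

/-- Translation estimate: `‖f(· + h) - f‖₂ ≤ |h| ‖∇f‖₂`. -/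
lemma lintegral_enorm_translate_sub_sq_le {f : Space3 → ℂ} (hf : MemLp f 2 volume) (h : Space3) :
    ∫⁻ x, ‖f (x + h) - f x‖ₑ ^ 2 ≤ ENNReal.ofReal (‖h‖ ^ 2) * gradNormSq Set.univ f := by
  -- A nonzero factor is needed to move it inside the infimum defining `gradNormSq`, whose value may
  -- be `∞`.
  rcases eq_or_ne h 0 with rfl | hh
  · simp
  have hpos : 0 < ‖h‖ ^ 2 := by have := norm_pos_iff.2 hh; positivity
  have hne : ENNReal.ofReal (‖h‖ ^ 2) ≠ 0 := (ENNReal.ofReal_pos.2 hpos).ne'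
  unfold gradNormSq
  rw [ENNReal.mul_iInf_of_ne hne ENNReal.ofReal_ne_top]
  refine le_iInf fun G => ?_
  rw [ENNReal.mul_iInf_of_ne hne ENNReal.ofReal_ne_top]
  refine le_iInf fun hG => ?_
  rw [Measure.restrict_univ]
  have hGm : ∀ j, AEStronglyMeasurable (G j) volume := fun j =>
    (locallyIntegrableOn_univ.1 (hG.grad_locallyIntegrableOn j)).aestronglyMeasurable
  rw [lintegral_finsetSum' _ fun j _ => (hGm j).enorm.pow_const 2]
  by_cases htop : ∃ j, ∫⁻ x, ‖G j x‖ₑ ^ 2 = ⊤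
  · obtain ⟨j, hj⟩ := htop
    have : ∑ j, ∫⁻ x, ‖G j x‖ₑ ^ 2 = ⊤ := ENNReal.sum_eq_top.2 ⟨j, Finset.mem_univ _, hj⟩
    rw [this, ENNReal.mul_top hne]
    exact le_top
  push Not at htop
  have hGL : ∀ j, MemLp (G j) 2 volume := fun j => by
    refine ⟨hGm j, ?_⟩
    have e := eLpNorm_nnreal_pow_eq_lintegral (p := 2) (f := G j) (μ := volume) two_ne_zero
    norm_num at e
    have := (htop j).lt_top
    rw [← e] at this
    exact (ENNReal.pow_lt_top_iff.1 this).resolve_right (by norm_num)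
  -- Real test functions commute with real-linear functionals, so real and imaginary parts inherit
  -- weak gradients and the real estimate applies to each.
  have htest : ∀ (u : ℂ →L[ℝ] ℝ) (j : Fin 3) (η : Space3 → ℝ), ContDiff ℝ ∞ η →
      HasCompactSupport η → ∫ x, fderiv ℝ η x (EuclideanSpace.single j 1) * u (f x) =
        - ∫ x, η x * u (G j x) := by
    intro u j η hη hηc
    have e := hG.integral_eq j η hη hηc (Set.subset_univ _)
    rw [Measure.restrict_univ] at e
    have i1 : Integrable fun x => fderiv ℝ η x (EuclideanSpace.single j 1) • f x :=
      (hf.locallyIntegrable (by norm_num)).integrable_smul_left_of_hasCompactSupport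
        ((hη.continuous_fderiv (by simp)).clm_apply continuous_const) (hηc.fderiv_apply ℝ _)
    have i2 : Integrable fun x => η x • G j x :=
      ((hGL j).locallyIntegrable (by norm_num)).integrable_smul_left_of_hasCompactSupport
        hη.continuous hηc
    have e' := congrArg u e
    rw [map_neg, ← u.integral_comp_comm i1, ← u.integral_comp_comm i2] at e'
    simpa only [map_smul, smul_eq_mul] using e'
  have hre := lintegral_enorm_translate_sub_sq_le_real (f := fun x => (f x).re)
    (G := fun j x => (G j x).re) hf.re (fun j => (hGL j).re) (htest Complex.reCLM) h
  have him := lintegral_enorm_translate_sub_sq_le_real (f := fun x => (f x).im)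
    (G := fun j x => (G j x).im) hf.im (fun j => (hGL j).im) (htest Complex.imCLM) h
  have hsq : ∀ {g : Space3 → ℂ}, AEStronglyMeasurable g volume →
      ∫⁻ x, ‖g x‖ₑ ^ 2 = (∫⁻ x, ‖(g x).re‖ₑ ^ 2) + ∫⁻ x, ‖(g x).im‖ₑ ^ 2 := fun {g} hg => by
    simp_rw [fun x => enorm_sq_eq_re_add_im (g x)]
    exact lintegral_add_left' ((Complex.continuous_re.comp_aestronglyMeasurable hg).enorm.pow_const 2) _
  have hfh : MemLp (fun x => f (x + h)) 2 volume :=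
    hf.comp_measurePreserving (measurePreserving_add_right volume h)
  have hd := hsq (hfh.1.sub hf.1)
  simp only [Pi.sub_apply, Complex.sub_re, Complex.sub_im] at hd
  rw [hd]
  simp_rw [fun j => hsq (hGm j)]
  rw [Finset.sum_add_distrib, mul_add]
  exact add_le_add hre him

/-! ### Local averages, Bessel's inequality and the mass in a ball -/

/-- Cauchy-Schwarz against the constant function. -/
lemma lintegral_sq_le_measure_mul {α : Type*} [MeasurableSpace α] {μ : Measure α}
    {g : α → ℝ≥0∞} (hg : AEMeasurable g μ) :
    (∫⁻ x, g x ∂μ) ^ 2 ≤ μ Set.univ * ∫⁻ x, g x ^ 2 ∂μ := by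
  have h := ENNReal.lintegral_mul_le_Lp_mul_Lq μ Real.HolderConjugate.two_two
    hg (aemeasurable_const (b := (1 : ℝ≥0∞)))
  simp only [Pi.mul_apply, mul_one, ENNReal.rpow_two] at h
  refine (pow_le_pow_left' h 2).trans (le_of_eq ?_)
  rw [mul_pow, ← ENNReal.rpow_two, ← ENNReal.rpow_two, ← ENNReal.rpow_mul, ← ENNReal.rpow_mul]
  norm_num [mul_comm]

/-- A value of `f` is controlled by the integral of `f` over the surrounding ball and the
mean oscillation on it. -/
lemma enorm_sq_mul_measure_sq_le {f : Space3 → ℂ} (hf : MemLp f 2 volume) (x : Space3) (l : ℝ) :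
    ‖f x‖ₑ ^ 2 * volume (Metric.closedBall (0 : Space3) l) ^ 2 ≤
      2 * ‖∫ z in Metric.closedBall x l, f z‖ₑ ^ 2 +
      2 * (volume (Metric.closedBall (0 : Space3) l) *
        ∫⁻ h in Metric.closedBall 0 l, ‖f (x + h) - f x‖ₑ ^ 2) := by
  set B := Metric.closedBall (0 : Space3) l with hB
  have hBtop : volume B ≠ ⊤ := measure_closedBall_lt_top.ne
  have hfx : MemLp (fun h => f (x + h)) 2 volume :=
    hf.comp_measurePreserving (measurePreserving_add_left volume x)
  have i1 : IntegrableOn (fun h => f (x + h)) B :=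
    (hfx.locallyIntegrable (by norm_num)).integrableOn_isCompact (isCompact_closedBall _ _)
  have i2 : IntegrableOn (fun _ : Space3 => f x) B := integrableOn_const hBtop
  have e1 : ∫ z in Metric.closedBall x l, f z = ∫ h in B, f (x + h) := by
    have := (measurePreserving_add_left volume x).setIntegral_preimage_emb
      (measurableEmbedding_addLeft x) f (Metric.closedBall x l)
    rw [← this, hB]
    simp
  -- Integrate `f x = f (x + h) - (f (x + h) - f x)` over `h ∈ B`.
  have e2 : (volume.real B : ℂ) * f x =
      (∫ z in Metric.closedBall x l, f z) - ∫ h in B, (f (x + h) - f x) := by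
    rw [integral_sub i1 i2, e1]
    simp
  have h3 : volume B * ‖f x‖ₑ ≤
      ‖∫ z in Metric.closedBall x l, f z‖ₑ + ∫⁻ h in B, ‖f (x + h) - f x‖ₑ := by
    calc volume B * ‖f x‖ₑ = ‖(volume.real B : ℂ) * f x‖ₑ := by
          rw [enorm_mul, ← ofReal_norm (volume.real B : ℂ), Complex.norm_real,
            Real.norm_of_nonneg measureReal_nonneg, ofReal_measureReal hBtop]
      _ ≤ _ := by
          rw [e2]
          exact enorm_sub_le.trans (add_le_add le_rfl (enorm_integral_le_lintegral_enorm _))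
  calc ‖f x‖ₑ ^ 2 * volume B ^ 2 = (volume B * ‖f x‖ₑ) ^ 2 := by rw [mul_pow, mul_comm]
    _ ≤ _ := pow_le_pow_left' h3 2
    _ ≤ _ := ENNReal.add_sq_le_two_mul _ _
    _ ≤ _ := by
        gcongr
        have := lintegral_sq_le_measure_mul (μ := volume.restrict B)
          (g := fun h => ‖f (x + h) - f x‖ₑ) (i1.1.sub i2.1).enorm
        simpa using this

/-- Bessel's inequality for the indicator of the ball, whose squared `L²` norm is the volume. The
bound does not depend on `N`. -/
lemma sum_enorm_integral_sq_le {N : ℕ} {φ : Fin N → Space3 → ℂ} (hφ : OrthonormalOrbitals φ)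
    (x : Space3) (l : ℝ) :
    ∑ i, ‖∫ z in Metric.closedBall x l, φ i z‖ₑ ^ 2 ≤
      volume (Metric.closedBall (0 : Space3) l) := by
  obtain ⟨hL, ho⟩ := hφ
  have hBm : MeasurableSet (Metric.closedBall x l) := Metric.isClosed_closedBall.measurableSet
  have hBtop : volume (Metric.closedBall x l) ≠ ⊤ := measure_closedBall_lt_top.ne
  set χ : Lp ℂ 2 (volume : Measure Space3) := indicatorConstLp 2 hBm hBtop (1 : ℂ)
  have h1 := ho.sum_inner_products_le χ (s := Finset.univ)
  have h2 : ∀ i, ‖inner ℂ ((hL i).toLp (φ i)) χ‖ = ‖∫ z in Metric.closedBall x l, φ i z‖ := by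
    intro i
    rw [norm_inner_symm, L2.inner_indicatorConstLp_one]
    congr 1
    exact integral_congr_ae (ae_restrict_of_ae (hL i).coeFn_toLp)
  have h3 : ‖χ‖ ^ 2 = volume.real (Metric.closedBall x l) := by
    rw [norm_indicatorConstLp (by norm_num) (by norm_num)]
    rw [norm_one, one_mul, ← Real.rpow_natCast, ← Real.rpow_mul measureReal_nonneg]
    norm_num
  simp_rw [h2] at h1
  rw [h3] at h1
  have h4 := ENNReal.ofReal_le_ofReal h1
  rw [ofReal_measureReal hBtop, ENNReal.ofReal_sum_of_nonneg fun _ _ => by positivity] at h4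
  simp_rw [ENNReal.ofReal_pow (norm_nonneg _), ofReal_norm] at h4
  rwa [Measure.addHaar_closedBall_center] at h4

lemma density_nonneg {N : ℕ} (φ : Fin N → Space3 → ℂ) (x : Space3) : 0 ≤ density φ x :=
  Finset.sum_nonneg fun _ _ => by positivity

lemma ofReal_density {N : ℕ} (φ : Fin N → Space3 → ℂ) (x : Space3) :
    ENNReal.ofReal (density φ x) = ∑ i, ‖φ i x‖ₑ ^ 2 := by
  rw [density, ENNReal.ofReal_sum_of_nonneg fun _ _ => by positivity]
  simp_rw [ENNReal.ofReal_pow (norm_nonneg _), ofReal_norm]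

lemma OrthonormalOrbitals.aestronglyMeasurable_density {N : ℕ} {φ : Fin N → Space3 → ℂ}
    (hφ : OrthonormalOrbitals φ) : AEStronglyMeasurable (density φ) volume := by
  obtain ⟨hL, -⟩ := hφ
  exact Finset.aestronglyMeasurable_fun_sum _ fun i _ => (hL i).1.norm.pow 2

lemma OrthonormalOrbitals.lintegral_density {N : ℕ} {φ : Fin N → Space3 → ℂ}
    (hφ : OrthonormalOrbitals φ) : ∫⁻ x, ENNReal.ofReal (density φ x) = ENNReal.ofReal N := by
  obtain ⟨hL, ho⟩ := hφ
  simp_rw [ofReal_density]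
  rw [lintegral_finsetSum' _ fun i _ => (hL i).1.enorm.pow_const 2]
  simp_rw [fun i => lintegral_enorm_sq_eq (hL i), fun i => ho.1 i]
  simp

/-- The mass of orthonormal orbitals in a ball: the averages over balls of radius `l` are
controlled by Bessel's inequality, the oscillations by the kinetic energy. -/
lemma lintegral_density_closedBall_le {N : ℕ} {φ : Fin N → Space3 → ℂ}
    (hφ : OrthonormalOrbitals φ) {T : ℝ} (hT : 0 ≤ T)
    (hkin : kineticEnergyOn Set.univ φ ≤ ENNReal.ofReal T) (y : Space3) {r l : ℝ} (hr : 0 < r)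
    (hl : 0 < l) :
    ∫⁻ x in Metric.closedBall y r, ENNReal.ofReal (density φ x) ≤
      ENNReal.ofReal (2 * (r ^ 3 / l ^ 3) + 2 * (l ^ 2 * T)) := by
  have hL := hφ.choose
  set B := Metric.closedBall (0 : Space3) l with hB
  set b := volume B with hb
  have hbtop : b ≠ ⊤ := measure_closedBall_lt_top.ne
  have hb0 : b ≠ 0 := (Metric.measure_closedBall_pos volume 0 hl).ne'
  -- The orbitals are measurable only up to null sets, so composition with `(x, h) ↦ x + h` goes
  -- through the measure-preserving shear `(x, h) ↦ (x, x + h)`.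
  have hprod : ∀ i, AEMeasurable (fun z : Space3 × Space3 => ‖φ i (z.1 + z.2) - φ i z.1‖ₑ ^ 2)
      (volume.prod (volume.restrict B)) := by
    intro i
    have h1 : AEStronglyMeasurable (fun z : Space3 × Space3 => φ i z.2)
        (volume.prod volume) := (hL i).1.comp_snd
    have h2 : AEStronglyMeasurable (fun z : Space3 × Space3 => φ i (z.1 + z.2))
        (volume.prod volume) := h1.comp_measurePreserving (measurePreserving_prod_add volume volume)
    have h3 : AEStronglyMeasurable (fun z : Space3 × Space3 => φ i z.1)
        (volume.prod volume) := (hL i).1.comp_fst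
    exact ((h2.sub h3).enorm.pow_const 2).mono_ac
      (Measure.AbsolutelyContinuous.rfl.prod Measure.restrict_le_self.absolutelyContinuous)
  -- Tonelli, then the translation estimate for each `h` with `‖h‖ ≤ l`.
  have hosc : ∀ i, ∫⁻ x, ∫⁻ h in B, ‖φ i (x + h) - φ i x‖ₑ ^ 2 ≤
      b * (ENNReal.ofReal (l ^ 2) * gradNormSq Set.univ (φ i)) := by
    intro i
    rw [lintegral_lintegral_swap (hprod i)]
    calc _ ≤ ∫⁻ _h in B, ENNReal.ofReal (l ^ 2) * gradNormSq Set.univ (φ i) := by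
          refine setLIntegral_mono' Metric.isClosed_closedBall.measurableSet fun h hh => ?_
          refine (lintegral_enorm_translate_sub_sq_le (hL i) h).trans ?_
          gcongr
          simpa [hB] using hh
      _ = _ := by rw [setLIntegral_const, mul_comm]
  have hpt : ∀ x, ENNReal.ofReal (density φ x) * b ^ 2 ≤
      2 * b + 2 * b * ∑ i, ∫⁻ h in B, ‖φ i (x + h) - φ i x‖ₑ ^ 2 := by
    intro x
    rw [ofReal_density, Finset.sum_mul]
    refine (Finset.sum_le_sum fun i _ => enorm_sq_mul_measure_sq_le (hL i) x l).trans ?_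
    rw [Finset.sum_add_distrib, ← Finset.mul_sum, ← Finset.mul_sum, ← Finset.mul_sum, ← mul_assoc]
    gcongr
    exact sum_enorm_integral_sq_le hφ x l
  have hmeas : ∀ i, AEMeasurable (fun x => ∫⁻ h in B, ‖φ i (x + h) - φ i x‖ₑ ^ 2) volume :=
    fun i => (hprod i).lintegral_prod_right'
  have hint : (∫⁻ x in Metric.closedBall y r, ENNReal.ofReal (density φ x)) * b ^ 2 ≤
      2 * b * volume (Metric.closedBall y r) + 2 * b * (b * (ENNReal.ofReal (l ^ 2 * T))) := by
    rw [← lintegral_mul_const' _ _ (by finiteness)]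
    refine (lintegral_mono hpt).trans ?_
    rw [lintegral_add_left measurable_const, setLIntegral_const]
    refine add_le_add le_rfl ?_
    refine (setLIntegral_le_lintegral _ _).trans ?_
    rw [lintegral_const_mul' _ _ (by finiteness), lintegral_finsetSum' _ fun i _ => hmeas i]
    refine mul_le_mul_right ((Finset.sum_le_sum fun i _ => hosc i).trans ?_) _
    rw [← Finset.mul_sum, ← Finset.mul_sum, ENNReal.ofReal_mul (by positivity)]
    gcongr
    exact hkin
  have hvr : volume (Metric.closedBall y r) = ENNReal.ofReal (r ^ 3 / l ^ 3) * b := by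
    rw [hb, hB, Measure.addHaar_closedBall _ _ hr.le, Measure.addHaar_closedBall _ _ hl.le,
      ← mul_assoc, ← ENNReal.ofReal_mul (by positivity)]
    simp only [finrank_euclideanSpace, Fintype.card_fin]
    rw [div_mul_cancel₀ _ (by positivity)]
  rw [hvr] at hint
  have hb2 : b ^ 2 ≠ 0 := pow_ne_zero 2 hb0
  rw [← ENNReal.mul_le_mul_iff_left hb2 (by finiteness)]
  refine hint.trans (le_of_eq ?_)
  rw [ENNReal.ofReal_add (by positivity) (by positivity),
    ENNReal.ofReal_mul (p := 2) (q := r ^ 3 / l ^ 3) (by norm_num),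
    ENNReal.ofReal_mul (p := 2) (q := l ^ 2 * T) (by norm_num)]
  simp only [ENNReal.ofReal_ofNat]
  ring

/-- The radius `l` is chosen with `l ^ 5 = r ^ 3 / T`, which makes `r ^ 3 / l ^ 3` and `l ^ 2 * T`
equal; the factor `4` is `2 + 2`. -/
lemma lintegral_density_closedBall_le_rpow {N : ℕ} {φ : Fin N → Space3 → ℂ}
    (hφ : OrthonormalOrbitals φ) {T : ℝ} (hT : 0 < T)
    (hkin : kineticEnergyOn Set.univ φ ≤ ENNReal.ofReal T) (y : Space3) {r : ℝ} (hr : 0 < r) :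
    ∫⁻ x in Metric.closedBall y r, ENNReal.ofReal (density φ x) ≤
      ENNReal.ofReal (4 * T ^ (3 / 5 : ℝ) * r ^ (6 / 5 : ℝ)) := by
  set l : ℝ := r ^ (3 / 5 : ℝ) * T ^ (-(1 / 5) : ℝ) with hl
  have hl0 : 0 < l := by positivity
  refine (lintegral_density_closedBall_le hφ hT.le hkin y hr hl0).trans (le_of_eq ?_)
  have p1 : ∀ {a b : ℝ} (n : ℕ), 0 < a → (a ^ b) ^ n = a ^ (b * n) := fun n ha => by
    rw [Real.rpow_mul ha.le, Real.rpow_natCast]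
  have e1 : r ^ 3 / l ^ 3 = T ^ (3 / 5 : ℝ) * r ^ (6 / 5 : ℝ) := by
    rw [div_eq_iff (by positivity), hl, mul_pow, p1 3 hr, p1 3 hT]
    calc r ^ 3 = T ^ (0 : ℝ) * r ^ (3 : ℝ) := by
          rw [Real.rpow_zero, one_mul]; exact_mod_cast (Real.rpow_natCast r 3).symm
      _ = (T ^ (3 / 5 : ℝ) * T ^ (-(1 / 5) * (3 : ℕ) : ℝ)) *
          (r ^ (6 / 5 : ℝ) * r ^ (3 / 5 * (3 : ℕ) : ℝ)) := by
          rw [← Real.rpow_add hT, ← Real.rpow_add hr]; norm_num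
      _ = _ := by ring
  have e2 : l ^ 2 * T = T ^ (3 / 5 : ℝ) * r ^ (6 / 5 : ℝ) := by
    rw [hl, mul_pow, p1 2 hr, p1 2 hT, mul_assoc]
    conv_lhs => rw [← Real.rpow_one T, ← Real.rpow_mul hT.le, ← Real.rpow_add hT]
    rw [mul_comm]
    norm_num
  rw [e1, e2]
  ring_nf

/-! ### Mean field under a kinetic energy bound -/

lemma potential_bounds {s : ℝ} {v : Space3 → ℝ}
    (hv : v = powerPotential s ∨ ∃ ε : ℝ, 0 < ε ∧ IsCutoffPotential s ε v) :
    AEStronglyMeasurable v volume ∧ (∀ x, 0 ≤ v x) ∧ ∀ x, x ≠ 0 → v x ≤ ‖x‖ ^ (-s) := by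
  rcases hv with rfl | ⟨ε, -, h⟩
  · refine ⟨?_, fun x => by unfold powerPotential; positivity, fun x _ => le_rfl⟩
    have : Measurable (powerPotential s) := by unfold powerPotential; fun_prop
    exact this.aestronglyMeasurable
  · exact ⟨h.memLp.1, h.nonneg, h.le_power⟩

/-- The mean field of orthonormal orbitals with kinetic energy at most `A N`. -/
lemma meanField_le_of_kineticEnergy {s : ℝ} (hs : 0 < s) (hs' : s < 6 / 5) :
    ∃ K : ℝ, 0 < K ∧
      ∀ A : ℝ, 0 < A → ∀ N : ℕ, 1 ≤ N → ∀ φ : Fin N → Space3 → ℂ,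
        OrthonormalOrbitals φ →
        kineticEnergyOn Set.univ φ ≤ ENNReal.ofReal (A * N) →
        ∀ v : Space3 → ℝ,
          (v = powerPotential s ∨ ∃ ε : ℝ, 0 < ε ∧ IsCutoffPotential s ε v) →
          ∀ y : Space3,
            ConvExistsAt (scaledPotential N (1 - s / 3) v) (density φ) y ∧
            conv (scaledPotential N (1 - s / 3) v) (density φ) y ≤ K * A ^ (s / 2) := by
  have hps : 0 < 6 / 5 - s := sub_pos.2 hs'
  refine ⟨6 / 5 / (6 / 5 - s) * 4 ^ (s / (6 / 5)), by positivity, ?_⟩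
  intro A hA N hN φ hφ hkin v hv y
  obtain ⟨hvm, hv0, hvs⟩ := potential_bounds hv
  have hN0 : (0 : ℝ) < N := by exact_mod_cast hN
  have hAN : 0 < A * N := by positivity
  obtain ⟨h1, h2⟩ := convExistsAt_and_conv_le (b := (N : ℝ) ^ (-(1 - s / 3))) hs hs' hN0
    (D := 4 * (A * N) ^ (3 / 5 : ℝ)) (by positivity) (by positivity) hvm hv0 hvs
    hφ.aestronglyMeasurable_density (density_nonneg φ) hφ.lintegral_density.le
    (fun y r hr => lintegral_density_closedBall_le_rpow hφ hAN hkin y hr) y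
  refine ⟨h1, h2.trans (le_of_eq ?_)⟩
  rw [Real.mul_rpow (by norm_num) (by positivity), ← Real.rpow_mul hAN.le,
    Real.mul_rpow hA.le hN0.le]
  -- The powers of `N` cancel: `-(1 - s/3) + (1 - 5s/6) + s/2 = 0`. This is what fixes the exponent
  -- `1 - s/3`.
  have e : (N : ℝ) ^ (-(1 - s / 3)) * ((N : ℝ) ^ (1 - s / (6 / 5)) *
      (N : ℝ) ^ (3 / 5 * (s / (6 / 5)))) = 1 := by
    rw [← Real.rpow_add hN0, ← Real.rpow_add hN0]
    convert Real.rpow_zero _ using 2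
    ring
  have e' : 3 / 5 * (s / (6 / 5)) = s / 2 := by ring
  rw [e'] at e ⊢
  linear_combination (6 / 5 / (6 / 5 - s) * 4 ^ (s / (6 / 5)) * A ^ (s / 2)) * e

/-! ### Weak gradients of smooth functions -/

lemma setIntegral_eq_integral_of_tsupport_subset {E : Type*} [NormedAddCommGroup E]
    [NormedSpace ℝ E] {Ω : Set Space3} {η : Space3 → ℝ} (hη : tsupport η ⊆ Ω) (g : Space3 → E) :
    ∫ x in Ω, η x • g x = ∫ x, η x • g x := by
  refine setIntegral_eq_integral_of_forall_compl_eq_zero fun x hx => ?_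
  rw [image_eq_zero_of_notMem_tsupport fun h => hx (hη h), zero_smul]

lemma integrableOn_smul_of_tsupport_subset {Ω : Set Space3} {η : Space3 → ℝ} (hη : Continuous η)
    (hc : HasCompactSupport η) (hs : tsupport η ⊆ Ω) {g : Space3 → ℂ}
    (hg : LocallyIntegrableOn g Ω volume) : Integrable (fun x => η x • g x) := by
  have h1 : IntegrableOn g (tsupport η) volume := hg.integrableOn_compact_subset hs hc
  have h2 : IntegrableOn (fun x => η x • g x) (tsupport η) volume :=
    h1.continuousOn_smul hη.continuousOn hc
  rw [← integrableOn_iff_integrable_of_support_subset (s := tsupport η)]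
  · exact h2
  · exact fun x hx => subset_tsupport η fun h => hx (by simp [h])

/-- The difference of two weak gradients integrates to zero against every test function in `Ω`,
hence vanishes almost everywhere there. So any one weak gradient computes the infimum in
`gradNormSq`. -/
lemma HasWeakGradientOn.ae_eq {Ω : Set Space3} (hΩ : IsOpen Ω) {f : Space3 → ℂ}
    {G G' : Fin 3 → Space3 → ℂ} (h : HasWeakGradientOn Ω f G) (h' : HasWeakGradientOn Ω f G')
    (j : Fin 3) : ∀ᵐ x ∂(volume : Measure Space3), x ∈ Ω → G j x = G' j x := by
  have hl := (h.grad_locallyIntegrableOn j).sub (h'.grad_locallyIntegrableOn j)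
  have := hΩ.ae_eq_zero_of_integral_contDiff_smul_eq_zero hl fun η hη hc hs => by
    have e1 := h.integral_eq j η hη hc hs
    have e2 := h'.integral_eq j η hη hc hs
    rw [e1, neg_inj, setIntegral_eq_integral_of_tsupport_subset hs,
      setIntegral_eq_integral_of_tsupport_subset hs] at e2
    have i1 := integrableOn_smul_of_tsupport_subset hη.continuous hc hs
      (h.grad_locallyIntegrableOn j)
    have i2 := integrableOn_smul_of_tsupport_subset hη.continuous hc hs
      (h'.grad_locallyIntegrableOn j)
    simp only [Pi.sub_apply, smul_sub]
    rw [integral_sub i1 i2, e2, sub_self]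
  filter_upwards [this] with x hx hxΩ
  exact sub_eq_zero.1 (hx hxΩ)

lemma HasWeakGradientOn.gradNormSq_eq {Ω : Set Space3} (hΩ : IsOpen Ω) {f : Space3 → ℂ}
    {G : Fin 3 → Space3 → ℂ} (h : HasWeakGradientOn Ω f G) :
    gradNormSq Ω f = ∫⁻ x in Ω, ∑ j, ‖G j x‖ₑ ^ 2 := by
  refine le_antisymm (iInf₂_le G h) (le_iInf₂ fun G' h' => le_of_eq ?_)
  refine lintegral_congr_ae ((ae_restrict_iff' hΩ.measurableSet).2 ?_)
  filter_upwards [ae_all_iff.2 fun j => h.ae_eq hΩ h' j] with x hx hxΩ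
  exact Finset.sum_congr rfl fun j _ => by rw [hx j hxΩ]

/-- A function that is smooth on `Ω` has its classical gradient as weak gradient. -/
lemma hasWeakGradientOn_of_contDiff {Ω : Set Space3} (hΩ : IsOpen Ω) {f F : Space3 → ℂ}
    (hF : ContDiff ℝ ∞ F) (hfF : Set.EqOn f F Ω) :
    HasWeakGradientOn Ω f fun j x => fderiv ℝ F x (EuclideanSpace.single j 1) := by
  have hcont : ∀ j : Fin 3, Continuous fun x => fderiv ℝ F x (EuclideanSpace.single j 1) :=
    fun j => (hF.continuous_fderiv (by simp)).clm_apply continuous_const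
  refine ⟨?_, fun j => ?_, fun j η hη hc hs => ?_⟩
  · exact (hF.continuous.continuousOn.congr hfF).locallyIntegrableOn hΩ.measurableSet
  · exact (hcont j).continuousOn.locallyIntegrableOn hΩ.measurableSet
  · have hηc : Continuous fun x => fderiv ℝ η x (EuclideanSpace.single j 1) :=
      (hη.continuous_fderiv (by simp)).clm_apply continuous_const
    have hηs : HasCompactSupport fun x => fderiv ℝ η x (EuclideanSpace.single j 1) :=
      hc.fderiv_apply ℝ _
    have hsub : tsupport (fun x => fderiv ℝ η x (EuclideanSpace.single j 1)) ⊆ Ω :=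
      (tsupport_fderiv_apply_subset ℝ _).trans hs
    rw [setIntegral_congr_fun hΩ.measurableSet (g := fun x =>
      fderiv ℝ η x (EuclideanSpace.single j 1) • F x) fun x hx => by simp only [hfF hx]]
    rw [setIntegral_eq_integral_of_tsupport_subset hsub,
      setIntegral_eq_integral_of_tsupport_subset hs,
      integral_smul_fderiv_eq_neg_fderiv_smul_of_integrable, neg_neg]
    · exact (hηc.smul hF.continuous).integrable_of_hasCompactSupport hηs.smul_right
    · exact (hη.continuous.smul (hcont j)).integrable_of_hasCompactSupport hc.smul_right
    · exact (hη.continuous.smul hF.continuous).integrable_of_hasCompactSupport hc.smul_right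
    · exact fun x _ => (hη.differentiable (by simp)).differentiableAt
    · exact fun x _ => (hF.differentiable (by simp)).differentiableAt

/-! ### The box -/

lemma box_eq_preimage (L : ℝ) :
    box L = (WithLp.ofLp : Space3 → Fin 3 → ℝ) ⁻¹'
      Set.univ.pi fun _ => Set.Icc (-(L / 2)) (L / 2) := by
  ext x
  simp [box, abs_le, Pi.le_def, forall_and]

lemma isClosed_box (L : ℝ) : IsClosed (box L) := by
  rw [box_eq_preimage]
  exact (isClosed_set_pi fun _ _ => isClosed_Icc).preimage (PiLp.continuous_ofLp 2 _)

lemma measurableSet_box (L : ℝ) : MeasurableSet (box L) := (isClosed_box L).measurableSet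

lemma interior_box_eq_preimage (L : ℝ) :
    interior (box L) = (WithLp.ofLp : Space3 → Fin 3 → ℝ) ⁻¹'
      Set.univ.pi fun _ => Set.Ioo (-(L / 2)) (L / 2) := by
  have h := ((EuclideanSpace.equiv (Fin 3) ℝ).toHomeomorph.preimage_interior
    (Set.univ.pi fun _ => Set.Icc (-(L / 2)) (L / 2))).symm
  rw [interior_pi_set Set.finite_univ] at h
  simp only [interior_Icc] at h
  rw [box_eq_preimage]
  exact h

lemma volume_box {L : ℝ} (hL : 0 < L) : volume (box L) = ENNReal.ofReal (L ^ 3) := by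
  rw [box_eq_preimage, (PiLp.volume_preserving_ofLp (Fin 3)).measure_preimage
    (MeasurableSet.univ_pi fun _ => measurableSet_Icc).nullMeasurableSet, volume_pi_pi]
  simp [← ENNReal.ofReal_pow hL.le]

lemma volume_interior_box {L : ℝ} (hL : 0 < L) :
    volume (interior (box L)) = ENNReal.ofReal (L ^ 3) := by
  rw [interior_box_eq_preimage, (PiLp.volume_preserving_ofLp (Fin 3)).measure_preimage
    (MeasurableSet.univ_pi fun _ => measurableSet_Ioo).nullMeasurableSet, volume_pi_pi]
  simp [← ENNReal.ofReal_pow hL.le]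

/-- Fubini on the box; it reduces orthogonality of plane waves to one dimension. -/
lemma setIntegral_box_prod {L : ℝ} (hL : 0 < L) (f : Fin 3 → ℝ → ℂ) :
    ∫ x in box L, ∏ j, f j (x j) = ∏ j, ∫ t in (-(L / 2))..(L / 2), f j t := by
  have h : ∀ j, ∫ t in (-(L / 2))..(L / 2), f j t =
      ∫ t, (Set.Icc (-(L / 2)) (L / 2)).indicator (f j) t := fun j => by
    rw [intervalIntegral.integral_of_le (by linarith), integral_indicator measurableSet_Icc,
      integral_Icc_eq_integral_Ioc]
  simp_rw [h]
  rw [← integral_fintype_prod_volume_eq_prod, ← integral_indicator (measurableSet_box L),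
    ← (PiLp.volume_preserving_ofLp (Fin 3)).integral_comp
      (MeasurableEquiv.toLp 2 (Fin 3 → ℝ)).symm.measurableEmbedding]
  congr 1
  ext x
  by_cases hx : x ∈ box L
  · rw [Set.indicator_of_mem hx]
    refine Finset.prod_congr rfl fun j _ => ?_
    rw [Set.indicator_of_mem]
    exact abs_le.1 (hx j)
  · rw [Set.indicator_of_notMem hx]
    simp only [box, Set.mem_ofPred_eq, not_forall] at hx
    obtain ⟨j, hj⟩ := hx
    refine (Finset.prod_eq_zero (Finset.mem_univ j) ?_).symm
    rw [Set.indicator_of_notMem]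
    exact fun h => hj (abs_le.2 h)

/-! ### Plane waves -/

/-- The plane wave on the whole space. -/
noncomputable def freeWave (L : ℝ) (k : Fin 3 → ℤ) (x : Space3) : ℂ :=
  ((L ^ (-(3 / 2 : ℝ)) : ℝ) : ℂ) *
    Complex.exp (Complex.I * ((2 * Real.pi / L * ∑ j, (k j : ℝ) * x j : ℝ) : ℂ))

lemma contDiff_freeWave (L : ℝ) (k : Fin 3 → ℤ) : ContDiff ℝ ∞ (freeWave L k) := by
  have h : ContDiff ℝ ∞ fun x : Space3 => 2 * Real.pi / L * ∑ j, (k j : ℝ) * x j := by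
    fun_prop
  have h' := Complex.ofRealCLM.contDiff.comp h
  exact contDiff_const.mul ((contDiff_const.mul h').cexp)

lemma fderiv_freeWave (L : ℝ) (k : Fin 3 → ℤ) (x : Space3) (j : Fin 3) :
    fderiv ℝ (freeWave L k) x (EuclideanSpace.single j 1) =
      Complex.I * ((2 * Real.pi / L * k j : ℝ) : ℂ) * freeWave L k x := by
  have hd : DifferentiableAt ℝ (freeWave L k) x :=
    ((contDiff_freeWave L k).differentiable (by simp)).differentiableAt
  rw [← hd.lineDeriv_eq_fderiv]
  refine HasLineDerivAt.lineDeriv ?_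
  unfold HasLineDerivAt
  have h1 : ∀ t : ℝ, 2 * Real.pi / L * ∑ i, (k i : ℝ) * (x + t • EuclideanSpace.single j (1 : ℝ)) i =
      2 * Real.pi / L * ∑ i, (k i : ℝ) * x i + t * (2 * Real.pi / L * k j) := by
    intro t
    have : ∑ i, (k i : ℝ) * (x + t • EuclideanSpace.single j (1 : ℝ)) i =
        ∑ i, (k i : ℝ) * x i + t * k j := by
      simp [mul_add, Finset.sum_add_distrib, mul_comm]
    rw [this]; ring
  have h2 : HasDerivAt (fun t : ℝ => 2 * Real.pi / L * ∑ i, (k i : ℝ) * x i +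
      t * (2 * Real.pi / L * k j)) (2 * Real.pi / L * k j) 0 := by
    simpa using ((hasDerivAt_id (0 : ℝ)).mul_const (2 * Real.pi / L * k j)).const_add
      (2 * Real.pi / L * ∑ i, (k i : ℝ) * x i)
  have h3 := ((h2.ofReal_comp.const_mul Complex.I).cexp).const_mul ((L ^ (-(3 / 2 : ℝ)) : ℝ) : ℂ)
  simp only [freeWave, h1]
  simp only [zero_mul, add_zero] at h3
  exact h3.congr_deriv (by ring)

lemma norm_freeWave_sq {L : ℝ} (hL : 0 < L) (k : Fin 3 → ℤ) (x : Space3) :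
    ‖freeWave L k x‖ ^ 2 = (L ^ 3)⁻¹ := by
  rw [freeWave, norm_mul, mul_comm Complex.I, Complex.norm_exp_ofReal_mul_I, Complex.norm_real,
    mul_one, Real.norm_of_nonneg (by positivity), ← Real.rpow_natCast, ← Real.rpow_mul hL.le,
    ← Real.rpow_natCast, ← Real.rpow_neg hL.le]
  norm_num

lemma planeWave_eq_indicator (L : ℝ) (k : Fin 3 → ℤ) :
    planeWave L k = (box L).indicator (freeWave L k) := rfl

lemma gradNormSq_planeWave {L : ℝ} (hL : 0 < L) (k : Fin 3 → ℤ) :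
    gradNormSq (interior (box L)) (planeWave L k) =
      ENNReal.ofReal ((2 * Real.pi / L) ^ 2 * ∑ j, (k j : ℝ) ^ 2) := by
  have hw := hasWeakGradientOn_of_contDiff isOpen_interior (contDiff_freeWave L k)
    (f := planeWave L k) (Ω := interior (box L))
    fun x hx => Set.indicator_of_mem (interior_subset hx) _
  rw [hw.gradNormSq_eq isOpen_interior]
  have h : ∀ x, ∑ j, ‖fderiv ℝ (freeWave L k) x (EuclideanSpace.single j 1)‖ₑ ^ 2 =
      ENNReal.ofReal ((2 * Real.pi / L) ^ 2 * (∑ j, (k j : ℝ) ^ 2) * (L ^ 3)⁻¹) := by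
    intro x
    rw [Finset.mul_sum, Finset.sum_mul, ENNReal.ofReal_sum_of_nonneg fun _ _ => by positivity]
    refine Finset.sum_congr rfl fun j _ => ?_
    rw [fderiv_freeWave, ← ofReal_norm, ← ENNReal.ofReal_pow (norm_nonneg _), norm_mul, norm_mul,
      Complex.norm_I, one_mul, mul_pow, norm_freeWave_sq hL, Complex.norm_real, Real.norm_eq_abs,
      sq_abs, mul_pow]
  simp_rw [h]
  rw [setLIntegral_const, volume_interior_box hL, ← ENNReal.ofReal_mul (by positivity),
    inv_mul_cancel_right₀ (by positivity)]

/-- For `m ≠ 0` the interval holds `|m|` full periods: the antiderivative takes the same value at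
both ends since `exp (2πi m) = 1`. -/
lemma integral_exp_int_mul {L : ℝ} (hL : 0 < L) (m : ℤ) :
    ∫ t in (-(L / 2))..(L / 2), Complex.exp (Complex.I * ((2 * Real.pi / L * (m * t) : ℝ) : ℂ)) =
      if m = 0 then (L : ℂ) else 0 := by
  split_ifs with hm
  · subst hm; simp
  set w : ℂ := Complex.I * ((2 * Real.pi / L * m : ℝ) : ℂ) with hw
  have hw0 : w ≠ 0 := by
    have : (2 * Real.pi / L * m : ℝ) ≠ 0 := by
      have : (m : ℝ) ≠ 0 := by exact_mod_cast hm
      have := Real.pi_pos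
      positivity
    exact mul_ne_zero Complex.I_ne_zero (by exact_mod_cast this)
  have e : ∀ t : ℝ, Complex.I * ((2 * Real.pi / L * (m * t) : ℝ) : ℂ) = w * t := fun t => by
    rw [hw]; push_cast; ring
  simp_rw [e]
  rw [integral_exp_mul_complex hw0]
  have hLc : (L : ℂ) ≠ 0 := by exact_mod_cast hL.ne'
  have e2 : w * ((L / 2 : ℝ) : ℂ) = w * ((-(L / 2) : ℝ) : ℂ) + m * (2 * Real.pi * Complex.I) := by
    rw [hw]; push_cast; field_simp; ring
  rw [e2, Complex.exp_add, Complex.exp_int_mul_two_pi_mul_I]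
  simp

lemma memLp_planeWave {L : ℝ} (hL : 0 < L) (k : Fin 3 → ℤ) :
    MemLp (planeWave L k) 2 (volume : Measure Space3) := by
  rw [planeWave_eq_indicator, memLp_indicator_iff_restrict (measurableSet_box L)]
  have : IsFiniteMeasure (volume.restrict (box L)) :=
    isFiniteMeasure_restrict.2 (by rw [volume_box hL]; exact ENNReal.ofReal_ne_top)
  refine MemLp.of_bound (contDiff_freeWave L k).continuous.aestronglyMeasurable
    (Real.sqrt (L ^ 3)⁻¹) (Filter.Eventually.of_forall fun x => ?_)
  exact Real.le_sqrt_of_sq_le (norm_freeWave_sq hL k x).le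

/-- The integrand factors over the coordinates, and a coordinate in which the momenta differ
contributes a vanishing factor. -/
lemma inner_planeWave {L : ℝ} (hL : 0 < L) (k k' : Fin 3 → ℤ) :
    inner ℂ ((memLp_planeWave hL k).toLp _) ((memLp_planeWave hL k').toLp _) =
      if k = k' then 1 else 0 := by
  rw [L2.inner_def]
  have h1 : ∫ x, inner ℂ ((memLp_planeWave hL k).toLp _ x) ((memLp_planeWave hL k').toLp _ x) =
      ∫ x in box L, ((L ^ 3 : ℝ) : ℂ)⁻¹ * ∏ j, Complex.exp
        (Complex.I * ((2 * Real.pi / L * ((k' j - k j : ℤ) * x j) : ℝ) : ℂ)) := by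
    rw [← integral_indicator (measurableSet_box L)]
    refine integral_congr_ae ?_
    filter_upwards [(memLp_planeWave hL k).coeFn_toLp, (memLp_planeWave hL k').coeFn_toLp]
      with x h1 h2
    rw [h1, h2, planeWave_eq_indicator, planeWave_eq_indicator]
    by_cases hx : x ∈ box L
    · simp only [Set.indicator_of_mem hx, freeWave, RCLike.inner_apply, map_mul, Complex.conj_ofReal,
        ← Complex.exp_conj, Complex.conj_I]
      rw [← Complex.exp_sum]
      have hc : ((L ^ (-(3 / 2 : ℝ)) : ℝ) : ℂ) * ((L ^ (-(3 / 2 : ℝ)) : ℝ) : ℂ) =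
          ((L ^ 3 : ℝ) : ℂ)⁻¹ := by
        rw [← Complex.ofReal_mul, ← Real.rpow_add hL, ← Complex.ofReal_inv, ← Real.rpow_natCast L 3,
          ← Real.rpow_neg hL.le]
        norm_num
      rw [← hc, mul_mul_mul_comm, ← Complex.exp_add]
      congr 2
      simp only [Fin.sum_univ_three]
      push_cast
      ring
    · simp [Set.indicator_of_notMem hx]
  rw [h1, integral_const_mul, setIntegral_box_prod hL (fun j t => Complex.exp
        (Complex.I * ((2 * Real.pi / L * ((k' j - k j : ℤ) * t) : ℝ) : ℂ)))]
  simp_rw [fun j => integral_exp_int_mul hL (k' j - k j)]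
  split_ifs with h
  · subst h
    have : (L : ℂ) ≠ 0 := by exact_mod_cast hL.ne'
    simp [this]
  · obtain ⟨j, hj⟩ := Function.ne_iff.1 h
    rw [Finset.prod_eq_zero (Finset.mem_univ j), mul_zero]
    rw [if_neg (sub_ne_zero.2 hj.symm)]

lemma orthonormalOrbitals_planeWave {L : ℝ} (hL : 0 < L) {N : ℕ} {k : Fin N → Fin 3 → ℤ}
    (hk : Function.Injective k) : OrthonormalOrbitals fun i => planeWave L (k i) := by
  refine ⟨fun i => memLp_planeWave hL (k i), orthonormal_iff_ite.2 fun i j => ?_⟩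
  rw [inner_planeWave hL]
  simp [hk.eq_iff]

/-! ### Momenta of the free ground state -/

/-- Greedy filling: a shortest unoccupied lattice point is added at each step. It exists because
squared lengths are natural numbers. -/
lemma exists_isGroundStateMomenta (N : ℕ) : ∃ k : Fin N → Fin 3 → ℤ, IsGroundStateMomenta k := by
  induction N with
  | zero => exact ⟨Fin.elim0, fun i => i.elim0, fun _ _ i => i.elim0⟩
  | succ N ih =>
    obtain ⟨k, hk, hmin⟩ := ih
    have hne : (Set.range k)ᶜ.Nonempty := (Set.finite_range k).infinite_compl.nonempty
    obtain ⟨m, hm, hmm⟩ := (InvImage.wf (fun m : Fin 3 → ℤ => (∑ j, m j ^ 2).toNat)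
      wellFounded_lt).has_min _ hne
    have hpos : ∀ m : Fin 3 → ℤ, 0 ≤ ∑ j, m j ^ 2 := fun m =>
      Finset.sum_nonneg fun _ _ => sq_nonneg _
    refine ⟨Fin.snoc k m, Fin.snoc_injective_iff.2 ⟨hk, hm⟩, fun m' hm' i => ?_⟩
    have hm'' : m' ∉ Set.range k := fun ⟨i, hi⟩ => hm' ⟨i.castSucc, by simp [hi]⟩
    refine Fin.lastCases ?_ (fun i => ?_) i
    · have := hmm m' hm''
      simp only [InvImage, not_lt] at this
      have h1 := hpos m
      have h2 := hpos m'
      simp only [Fin.snoc_last]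
      omega
    · simpa using hmin m' hm'' i

/-- All momenta of the ground state of `N` particles have length at most `√3 N ^ (1 / 3)`. -/
lemma IsGroundStateMomenta.sum_sq_le {N : ℕ} {k : Fin N → Fin 3 → ℤ}
    (hk : IsGroundStateMomenta k) (i : Fin N) :
    ∑ j, (k i j : ℝ) ^ 2 ≤ 3 * (N : ℝ) ^ (2 / 3 : ℝ) := by
  set S : ℝ := ∑ j, (k i j : ℝ) ^ 2 with hS
  -- Every natural number below `n` has square less than `S / 3`, so all points of the cube `{0, …,
  -- n - 1}³` are shorter than `k i` and must be occupied. Hence `n ^ 3 ≤ N`, while `S / 3 ≤ n ^ 2`.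
  set n : ℕ := ⌈Real.sqrt (S / 3)⌉₊ with hn
  have hmem : ∀ m : Fin 3 → Fin n, (fun j => ((m j : ℕ) : ℤ)) ∈ Set.range k := by
    intro m
    by_contra hm
    have h1 := hk.2 _ hm i
    have h2 : S ≤ ∑ j, ((m j : ℕ) : ℝ) ^ 2 := by rw [hS]; exact_mod_cast h1
    have h3 : ∀ j, ((m j : ℕ) : ℝ) ^ 2 < S / 3 := fun j =>
      (Real.lt_sqrt (by positivity)).1 (Nat.lt_ceil.1 (m j).2)
    have h4 := Finset.sum_lt_sum_of_nonempty (s := Finset.univ) Finset.univ_nonempty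
      fun j _ => h3 j
    rw [Finset.sum_const, Finset.card_univ, Fintype.card_fin, nsmul_eq_mul] at h4
    push_cast at h4
    linarith
  choose f hf using hmem
  have hinj : Function.Injective f := by
    intro m m' h
    have h1 := (hf m).symm.trans ((congrArg k h).trans (hf m'))
    ext j
    simpa using congrFun h1 j
  have hcard : n ^ 3 ≤ N := by simpa using Fintype.card_le_of_injective f hinj
  have h1 : S / 3 ≤ (n : ℝ) ^ 2 := (Real.sqrt_le_left (by positivity)).1 (Nat.le_ceil _)
  have h2 : (n : ℝ) ^ 2 ≤ (N : ℝ) ^ (2 / 3 : ℝ) := by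
    calc (n : ℝ) ^ 2 = ((n : ℝ) ^ 3) ^ (2 / 3 : ℝ) := by
          rw [← Real.rpow_natCast, ← Real.rpow_natCast, ← Real.rpow_mul (by positivity)]
          norm_num
      _ ≤ _ := Real.rpow_le_rpow (by positivity) (by exact_mod_cast hcard) (by norm_num)
  linarith

/-! ### Density and kinetic energy of plane waves at fixed density -/

lemma sideLength_pos {c : ℝ} (hc : 0 < c) {N : ℕ} (hN : 1 ≤ N) : 0 < sideLength c N := by
  have : (0 : ℝ) < N := by exact_mod_cast hN
  unfold sideLength; positivity

lemma sideLength_rpow {c : ℝ} (hc : 0 < c) (N : ℕ) (a : ℝ) :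
    sideLength c N ^ a = ((N : ℝ) / c) ^ (a / 3) := by
  rw [sideLength, ← Real.rpow_mul (by positivity)]
  congr 1; ring

lemma mul_sideLength_pow {c : ℝ} (hc : 0 < c) (N : ℕ) : c * sideLength c N ^ 3 = N := by
  rw [← Real.rpow_natCast, sideLength_rpow hc]
  norm_num
  field_simp

lemma density_planeWaves {c : ℝ} (hc : 0 < c) {N : ℕ} (hN : 1 ≤ N) (k : Fin N → Fin 3 → ℤ) :
    density (planeWaves c k) = (box (sideLength c N)).indicator fun _ => c := by
  have hL := sideLength_pos hc hN
  ext x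
  simp only [density, planeWaves, planeWave_eq_indicator]
  by_cases hx : x ∈ box (sideLength c N)
  · simp only [Set.indicator_of_mem hx, norm_freeWave_sq hL]
    rw [Finset.sum_const, Finset.card_univ, Fintype.card_fin, nsmul_eq_mul,
      ← mul_sideLength_pow hc N]
    exact mul_inv_cancel_right₀ (by positivity) c
  · simp [Set.indicator_of_notMem hx]

lemma kineticEnergyOn_planeWaves {c : ℝ} (hc : 0 < c) {N : ℕ} (hN : 1 ≤ N)
    (k : Fin N → Fin 3 → ℤ) :
    kineticEnergyOn (interior (box (sideLength c N))) (planeWaves c k) =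
      ENNReal.ofReal (∑ i, (2 * Real.pi / sideLength c N) ^ 2 * ∑ j, (k i j : ℝ) ^ 2) := by
  rw [ENNReal.ofReal_sum_of_nonneg fun _ _ => by positivity]
  exact Finset.sum_congr rfl fun i _ => gradNormSq_planeWave (sideLength_pos hc hN) (k i)

lemma IsGroundStateMomenta.kineticEnergy_le {c : ℝ} (hc : 0 < c) {N : ℕ} (hN : 1 ≤ N)
    {k : Fin N → Fin 3 → ℤ} (hk : IsGroundStateMomenta k) :
    ∑ i, (2 * Real.pi / sideLength c N) ^ 2 * ∑ j, (k i j : ℝ) ^ 2 ≤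
      12 * Real.pi ^ 2 * c ^ (2 / 3 : ℝ) * N := by
  have hN0 : (0 : ℝ) < N := by exact_mod_cast hN
  have h2 : sideLength c N ^ 2 = (N : ℝ) ^ (2 / 3 : ℝ) / c ^ (2 / 3 : ℝ) := by
    rw [← Real.rpow_natCast, sideLength_rpow hc, Real.div_rpow hN0.le hc.le]
    norm_num
  have hterm : ∀ i, (2 * Real.pi / sideLength c N) ^ 2 * ∑ j, (k i j : ℝ) ^ 2 ≤
      12 * Real.pi ^ 2 * c ^ (2 / 3 : ℝ) := by
    intro i
    -- The constant `12 π²` is `(2π)²` times the `3` of the momentum bound.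
    refine (mul_le_mul_of_nonneg_left (hk.sum_sq_le i) (by positivity)).trans (le_of_eq ?_)
    have : (0 : ℝ) < (N : ℝ) ^ (2 / 3 : ℝ) := by positivity
    rw [div_pow, h2]
    field_simp
    ring
  refine (Finset.sum_le_sum fun i _ => hterm i).trans (le_of_eq ?_)
  rw [Finset.sum_const, Finset.card_univ, Fintype.card_fin, nsmul_eq_mul, mul_comm]

lemma norm_le_of_mem_box {L : ℝ} (hL : 0 ≤ L) {x : Space3} (hx : x ∈ box L) : ‖x‖ ≤ L := by
  refine (sq_le_sq₀ (norm_nonneg _) hL).1 ?_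
  have h : ∀ j, x j ^ 2 ≤ (L / 2) ^ 2 := fun j => sq_le_sq' (abs_le.1 (hx j)).1 (abs_le.1 (hx j)).2
  rw [EuclideanSpace.norm_sq_eq, Fin.sum_univ_three]
  simp only [Real.norm_eq_abs, sq_abs]
  nlinarith [h 0, h 1, h 2]

lemma lintegral_indicator_closedBall_le {c L : ℝ} (hc : 0 < c) (y : Space3) {r : ℝ}
    (hr : 0 < r) :
    ∫⁻ x in Metric.closedBall y r, ENNReal.ofReal ((box L).indicator (fun _ => c) x) ≤
      ENNReal.ofReal (c * volume.real (Metric.ball (0 : Space3) 1) * r ^ (3 : ℝ)) := by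
  calc _ ≤ ∫⁻ _x in Metric.closedBall y r, ENNReal.ofReal c :=
        lintegral_mono fun x => ENNReal.ofReal_le_ofReal
          (Set.indicator_le_self' (fun _ _ => hc.le) x)
    _ = _ := by
        have h3 : r ^ (3 : ℝ) = r ^ 3 := by exact_mod_cast Real.rpow_natCast r 3
        rw [setLIntegral_const, Measure.addHaar_closedBall _ _ hr.le, finrank_euclideanSpace,
          Fintype.card_fin, mul_assoc, ENNReal.ofReal_mul hc.le, mul_comm (volume.real _), h3,
          ENNReal.ofReal_mul (by positivity), ofReal_measureReal measure_ball_lt_top.ne]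

/-! ### Mean field of plane waves -/

/-- Upper bound for the mean field of plane waves of density `c`. -/
lemma meanField_planeWaves_le {s : ℝ} (hs : 0 < s) (hs' : s < 6 / 5) :
    ∃ K : ℝ, 0 < K ∧
      ∀ c : ℝ, 0 < c → ∀ N : ℕ, 1 ≤ N → ∀ k : Fin N → Fin 3 → ℤ, IsGroundStateMomenta k →
        ∀ v : Space3 → ℝ,
          (v = powerPotential s ∨ ∃ ε : ℝ, 0 < ε ∧ IsCutoffPotential s ε v) →
          ∀ y : Space3,
            ConvExistsAt (scaledPotential N (1 - s / 3) v) (density (planeWaves c k)) y ∧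
            conv (scaledPotential N (1 - s / 3) v) (density (planeWaves c k)) y
              ≤ K * c ^ (s / 3) := by
  set w := volume.real (Metric.ball (0 : Space3) 1) with hw
  have hw0 : 0 < w := ENNReal.toReal_pos (Metric.measure_ball_pos volume 0 one_pos).ne'
    measure_ball_lt_top.ne
  have hps : 0 < 3 - s := by linarith
  refine ⟨3 / (3 - s) * w ^ (s / 3), by positivity, ?_⟩
  intro c hc N hN k hk v hv y
  obtain ⟨hvm, hv0, hvs⟩ := potential_bounds hv
  have hN0 : (0 : ℝ) < N := by exact_mod_cast hN
  have ho : OrthonormalOrbitals (planeWaves c k) :=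
    orthonormalOrbitals_planeWave (sideLength_pos hc hN) hk.1
  obtain ⟨h1, h2⟩ := convExistsAt_and_conv_le (b := (N : ℝ) ^ (-(1 - s / 3))) hs
    (sub_pos.1 hps) hN0 (D := c * w) (by positivity) (by positivity) hvm hv0 hvs
    ho.aestronglyMeasurable_density (density_nonneg _) ho.lintegral_density.le
    (fun y r hr => by
      rw [density_planeWaves hc hN]
      exact lintegral_indicator_closedBall_le hc y hr) y
  refine ⟨h1, h2.trans (le_of_eq ?_)⟩
  have e : (N : ℝ) ^ (-(1 - s / 3)) * (N : ℝ) ^ (1 - s / 3) = 1 := by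
    rw [← Real.rpow_add hN0, neg_add_cancel, Real.rpow_zero]
  rw [Real.mul_rpow hc.le hw0.le]
  linear_combination (3 / (3 - s) * w ^ (s / 3) * c ^ (s / 3)) * e

/-- Lower bound for the mean field of plane waves of density `c`, when the potential is known
outside a ball that carries at most half of the mass. -/
lemma le_meanField_planeWaves {s : ℝ} (hs : 0 < s) {κ : ℝ} (hκ : 0 < κ) {c : ℝ} (hc : 0 < c)
    {N : ℕ} (hN : 1 ≤ N) (k : Fin N → Fin 3 → ℤ) {v : Space3 → ℝ} {ε : ℝ} (hε0 : 0 ≤ ε)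
    (hv0 : ∀ x, 0 ≤ v x) (hv : ∀ x, ε < ‖x‖ → v x = ‖x‖ ^ (-s))
    (hε : 2 * (c * volume.real (Metric.closedBall (0 : Space3) ε)) ≤ N) {y : Space3}
    (hex : ConvExistsAt (scaledPotential N (1 - s / 3) v) (density (planeWaves c k)) y)
    (hy : ‖y‖ ≤ κ * sideLength c N) :
    (κ + 1) ^ (-s) / 2 * c ^ (s / 3) ≤
      conv (scaledPotential N (1 - s / 3) v) (density (planeWaves c k)) y := by
  have hN0 : (0 : ℝ) < N := by exact_mod_cast hN
  have hL := sideLength_pos hc hN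
  have hcL := mul_sideLength_pow hc N
  have hLs : sideLength c N ^ (-s) = (N : ℝ) ^ (-s / 3) * c ^ (s / 3) := by
    rw [sideLength_rpow hc, Real.div_rpow hN0.le hc.le, neg_div 3 s, Real.rpow_neg hc.le, div_inv_eq_mul]
  set L := sideLength c N with hLdef
  set b : ℝ := (N : ℝ) ^ (-(1 - s / 3)) with hb
  set B : Set Space3 := Metric.closedBall 0 ε with hB
  -- The displacements `t` for which `y - t` lies in the box and `v t` is known exactly.
  set S : Set Space3 := (fun t => y - t) ⁻¹' box L \ B with hS
  have hpm : MeasurableSet ((fun t => y - t) ⁻¹' box L) :=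
    (measurableSet_box L).preimage (by fun_prop)
  have hSm : MeasurableSet S := hpm.diff Metric.isClosed_closedBall.measurableSet
  have hpv : volume ((fun t => y - t) ⁻¹' box L) = ENNReal.ofReal (L ^ 3) := by
    rw [(Measure.measurePreserving_sub_left volume y).measure_preimage
      (measurableSet_box L).nullMeasurableSet, volume_box hL]
  have hSfin : volume S ≠ ⊤ :=
    ((measure_mono Set.sdiff_subset).trans_lt (by rw [hpv]; exact ENNReal.ofReal_lt_top)).ne
  -- The box carries mass `c L³ = N`, and by `hε` the removed ball takes at most half of it.
  have hSv : (N : ℝ) / 2 ≤ c * volume.real S := by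
    have h1 : L ^ 3 ≤ volume.real S + volume.real B := by
      have h2 : volume.real ((fun t => y - t) ⁻¹' box L) = L ^ 3 := by
        rw [measureReal_def, hpv, ENNReal.toReal_ofReal (by positivity)]
      rw [← h2]
      refine (measureReal_mono ?_ ?_).trans (measureReal_union_le S B)
      · rw [hS, Set.sdiff_union_self]; exact Set.subset_union_left
      · exact (measure_union_lt_top hSfin.lt_top measure_closedBall_lt_top).ne
    have := mul_le_mul_of_nonneg_left h1 hc.le
    rw [hcL] at this
    linarith
  have hex' : Integrable (fun t => b * v t * density (planeWaves c k) (y - t)) volume := hex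
  have hconv : conv (scaledPotential N (1 - s / 3) v) (density (planeWaves c k)) y =
      ∫ t, b * v t * density (planeWaves c k) (y - t) := rfl
  have hpt : ∀ t ∈ S, b * ((κ + 1) * L) ^ (-s) * c ≤
      b * v t * density (planeWaves c k) (y - t) := by
    intro t ht
    have htB : ε < ‖t‖ := by simpa [hB] using ht.2
    have ht0 : 0 < ‖t‖ := hε0.trans_lt htB
    have htL : ‖t‖ ≤ (κ + 1) * L := by
      have h1 := norm_le_of_mem_box hL.le ht.1
      have h2 := norm_sub_le y (y - t)
      rw [sub_sub_cancel] at h2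
      linarith
    rw [density_planeWaves hc hN, Set.indicator_of_mem (by exact ht.1), hv t htB]
    have := Real.rpow_le_rpow_of_nonpos ht0 htL (neg_nonpos.2 hs.le)
    gcongr
  rw [hconv]
  calc (κ + 1) ^ (-s) / 2 * c ^ (s / 3)
      = b * ((κ + 1) * L) ^ (-s) * (N / 2) := by
        have e : b * (N : ℝ) ^ (-s / 3) * N = 1 := by
          conv_lhs => rw [hb, ← Real.rpow_add hN0, ← Real.rpow_add_one hN0.ne']
          convert Real.rpow_zero _ using 2
          ring
        rw [Real.mul_rpow (by positivity) hL.le, hLs]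
        linear_combination (-(κ + 1) ^ (-s) / 2 * c ^ (s / 3)) * e
    _ ≤ b * ((κ + 1) * L) ^ (-s) * (c * volume.real S) :=
        mul_le_mul_of_nonneg_left hSv (by positivity)
    _ = ∫ _t in S, b * ((κ + 1) * L) ^ (-s) * c := by
        rw [setIntegral_const, smul_eq_mul]; ring
    _ ≤ ∫ t in S, b * v t * density (planeWaves c k) (y - t) :=
        setIntegral_mono_on (integrableOn_const hSfin) hex'.integrableOn hSm hpt
    _ ≤ _ := setIntegral_le_integral hex' (Filter.Eventually.of_forall fun t =>
        mul_nonneg (mul_nonneg (by positivity) (hv0 t)) (density_nonneg _ _))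

theorem mainTheorem9 :
    -- upper bound, with a constant `K * A ^ (s / 2)` where `K` depends on `s` only
    (∀ s : ℝ, 0 < s → s < 6 / 5 → ∃ K : ℝ, 0 < K ∧
      ∀ A : ℝ, 0 < A → ∀ N : ℕ, 1 ≤ N → ∀ φ : Fin N → Space3 → ℂ,
        OrthonormalOrbitals φ →
        kineticEnergyOn Set.univ φ ≤ ENNReal.ofReal (A * N) →
        ∀ v : Space3 → ℝ,
          (v = powerPotential s ∨ ∃ ε : ℝ, 0 < ε ∧ IsCutoffPotential s ε v) →
          ∀ y : Space3,
            ConvExistsAt (scaledPotential N (1 - s / 3) v) (density φ) y ∧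
            conv (scaledPotential N (1 - s / 3) v) (density φ) y ≤ K * A ^ (s / 2)) ∧
    -- plane waves of constant density `c`: orthonormal, kinetic energy (in the box) `O(N)`
    (∀ N : ℕ, ∃ k : Fin N → Fin 3 → ℤ, IsGroundStateMomenta k) ∧
    (∃ A₀ : ℝ, 0 < A₀ ∧ ∀ c : ℝ, 0 < c → ∀ N : ℕ, 1 ≤ N → ∀ k : Fin N → Fin 3 → ℤ,
      IsGroundStateMomenta k →
        OrthonormalOrbitals (planeWaves c k) ∧
        density (planeWaves c k) = (box (sideLength c N)).indicator (fun _ => c) ∧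
        kineticEnergyOn (interior (box (sideLength c N))) (planeWaves c k) =
          ENNReal.ofReal (∑ i, (2 * Real.pi / sideLength c N) ^ 2 * ∑ j, (k i j : ℝ) ^ 2) ∧
        kineticEnergyOn (interior (box (sideLength c N))) (planeWaves c k) ≤
          ENNReal.ofReal (A₀ * c ^ (2 / 3 : ℝ) * N)) ∧
    -- for plane waves the order is attained: upper bound for all `y` ...
    (∀ s : ℝ, 0 < s → s < 6 / 5 → ∃ K : ℝ, 0 < K ∧
      ∀ c : ℝ, 0 < c → ∀ N : ℕ, 1 ≤ N → ∀ k : Fin N → Fin 3 → ℤ, IsGroundStateMomenta k →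
        ∀ v : Space3 → ℝ,
          (v = powerPotential s ∨ ∃ ε : ℝ, 0 < ε ∧ IsCutoffPotential s ε v) →
          ∀ y : Space3,
            ConvExistsAt (scaledPotential N (1 - s / 3) v) (density (planeWaves c k)) y ∧
            conv (scaledPotential N (1 - s / 3) v) (density (planeWaves c k)) y
              ≤ K * c ^ (s / 3)) ∧
    -- ... and lower bound for all `y` with `|y| ≤ κ L`
    (∀ s : ℝ, 0 < s → s < 6 / 5 → ∀ κ : ℝ, 0 < κ → ∃ K' : ℝ, 0 < K' ∧ ∀ c : ℝ, 0 < c →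
      (∀ N : ℕ, 1 ≤ N → ∀ k : Fin N → Fin 3 → ℤ, IsGroundStateMomenta k →
        ∀ y : Space3, ‖y‖ ≤ κ * sideLength c N →
          K' * c ^ (s / 3) ≤
            conv (scaledPotential N (1 - s / 3) (powerPotential s))
              (density (planeWaves c k)) y) ∧
      (∀ ε : ℝ, 0 < ε → ∃ N₀ : ℕ, ∀ N : ℕ, 1 ≤ N → N₀ ≤ N →
        ∀ k : Fin N → Fin 3 → ℤ, IsGroundStateMomenta k →
        ∀ v : Space3 → ℝ, IsCutoffPotential s ε v →
        ∀ y : Space3, ‖y‖ ≤ κ * sideLength c N →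
          K' * c ^ (s / 3) ≤
            conv (scaledPotential N (1 - s / 3) v) (density (planeWaves c k)) y)) := by
  refine ⟨fun s hs hs' => meanField_le_of_kineticEnergy hs hs', exists_isGroundStateMomenta,
    ⟨12 * Real.pi ^ 2, by positivity, ?_⟩, fun s hs hs' => meanField_planeWaves_le hs hs', ?_⟩
  · intro c hc N hN k hk
    have hkin := kineticEnergyOn_planeWaves hc hN k
    exact ⟨orthonormalOrbitals_planeWave (sideLength_pos hc hN) hk.1, density_planeWaves hc hN k,
      hkin, hkin.trans_le (ENNReal.ofReal_le_ofReal (hk.kineticEnergy_le hc hN))⟩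
  · intro s hs hs' κ hκ
    obtain ⟨K, -, hK⟩ := meanField_planeWaves_le hs hs'
    refine ⟨(κ + 1) ^ (-s) / 2, by positivity, fun c hc => ⟨?_, ?_⟩⟩
    · intro N hN k hk y hy
      -- The pure power is known everywhere, so `ε = 0` is allowed: the removed ball is a point and
      -- has volume zero.
      refine le_meanField_planeWaves hs hκ hc hN k le_rfl (potential_bounds (Or.inl rfl)).2.1
        (fun _ _ => rfl) ?_ (hK c hc N hN k hk _ (Or.inl rfl) y).1 hy
      simp [measureReal_def]
    · intro ε hε
      -- Exactly the condition that the ball of radius `ε` carries at most half of the mass; it does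
      -- not involve the particular cutoff `v`.
      refine ⟨⌈2 * (c * volume.real (Metric.closedBall (0 : Space3) ε))⌉₊, ?_⟩
      intro N hN hN₀ k hk v hv y hy
      exact le_meanField_planeWaves hs hκ hc hN k hε.le hv.nonneg
        (fun x hx => hv.eq_of_le x hx.le) (Nat.ceil_le.1 hN₀)
        (hK c hc N hN k hk v (Or.inr ⟨ε, hε, hv⟩) y).1 hy
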